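/- Let $\ell>0$ and $R>0$, and consider fields $w=(u,v)$ on the strip $\mathbb R\times[0,1]$ that are $\ell$-periodic in $x$. Let $X$ be the closure in $L_2(\Omega;\mathbb C^2)$, $\Omega=[0,\ell]\times[0,1]$, of the smooth $\ell$-periodic divergence-free fields $(u,v)$ with $v=0$ on the walls $y=0,1$ and with no net flux, $\int_0^1u\,dy=0$ (i.e. the fields $(-\psi_y,\psi_x)$ of a periodic stream function $\psi$ vanishing on both walls). Let $W=(y,0)$ and let $\mathcal L_R$ be the closed operator in $X$ obtained as the closure of $$\mathcal L_Rw=\tfrac1R\Delta w-(w\cdot\nabla)W-(W\cdot\nabla)w-\nabla p$$ on the smooth fields of this kind with $w=0$ on the walls, where $p$ is smooth, has $\ell$-periodic gradient, solves $\Delta p=-\nabla\cdot((w\cdot\nabla)W)-\nabla\cdot((W\cdot\nabla)w)$ with $p_y=\tfrac1Rv_{yy}$ at $y=0,1$, and has the mean pressure gradient for which $\mathcal L_Rw$ has no net flux. Let $C\ge0$ and let $s\in\mathbb C$ satisfy $|s|<2\sqrt2(1+\sqrt R)$. Write $\|f\|^2=\int_0^1|f|^2\,dy$ and $\kappa=2\pi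 k/\ell$ for $k\in\mathbb Z$. Suppose that for every $k\in\mathbb Z$, for all smooth $\widehat F,\widehat G:[0,1]\to\mathbb C$ with $i\kappa\widehat F+\widehat G'=0$, $\widehat G(0)=\widehat G(1)=0$, $\int_0^1\widehat F\,dy=0$, every smooth solution $\widehat\psi$ of $$\tfrac1R\widehat\psi''''-\Big(s+\tfrac{2\kappa^2}R+i\kappa y\Big)\widehat\psi''+\Big(s\kappa^2+\tfrac{\kappa^4}R+i\kappa^3y\Big)\widehat\psi=\widehat F'-i\kappa\widehat G,\qquad \widehat\psi(0)=\widehat\psi(1)=\widehat\psi'(0)=\widehat\psi'(1)=0,$$ satisfies $$\kappa^2\|\widehat\psi\|^2\le CR^2(\|\widehat F\|^2+\|\widehat G\|^2),\qquad \|\widehat\psi'\|^2\le CR^2(\|\widehat F\|^2+\|\widehat G\|^2).$$ Then $(s\mathcal I-\mathcal L_R)^{-1}$ exists as a bounded operator on all of $X$, and $$\|(s\mathcal I-\mathcal L_R)^{-1}\|^2\le 2CR^2 .$$ In particular, if the estimates hold for all $s$ in a subset of the disc $|s|<2\sqrt2(1+\sqrt R)$ (such as its part in $\operatorname{Re}s\ge0$),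 then the resolvent bound holds on that subset. -/

import Mathlib

open MeasureTheory
open scoped ContDiff

noncomputable section

namespace Couette

/-! Points of the strip are pairs `z = (x, y)`; the strip is `y ∈ [0, 1]`, and every field is periodic
in `x` with period `ℓ`. Smooth functions on the closed strip are represented by smooth functions on
the plane, and all equations are imposed on the strip only. -/

/-- The partial derivative in `x`. -/
def dx (f : ℝ × ℝ → ℂ) (z : ℝ × ℝ) : ℂ := fderiv ℝ f z (1, 0)

/-- The partial derivative in `y`. -/
def dy (f : ℝ × ℝ → ℂ) (z : ℝ × ℝ) : ℂ := fderiv ℝ f z (0, 1)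

/-- The Laplacian. -/
def lap (f : ℝ × ℝ → ℂ) (z : ℝ × ℝ) : ℂ := dx (dx f) z + dy (dy f) z

/-- First component of `(w · ∇) W + (W · ∇) w` for `w = (u, v)` and the Couette flow `W = (y, 0)`. -/
def advU (u v : ℝ × ℝ → ℂ) (z : ℝ × ℝ) : ℂ := v z + (z.2 : ℂ) * dx u z

/-- Second component of `(w · ∇) W + (W · ∇) w` for `w = (u, v)` and the Couette flow `W = (y, 0)`. -/
def advV (v : ℝ × ℝ → ℂ) (z : ℝ × ℝ) : ℂ := (z.2 : ℂ) * dx v z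

/-- First component of `(1/R) Δw - (w · ∇) W - (W · ∇) w - ∇p`. -/
def rhsU (R : ℝ) (u v p : ℝ × ℝ → ℂ) (z : ℝ × ℝ) : ℂ :=
  (1 / R : ℂ) * lap u z - advU u v z - dx p z

/-- Second component of `(1/R) Δw - (w · ∇) W - (W · ∇) w - ∇p`. -/
def rhsV (R : ℝ) (v p : ℝ × ℝ → ℂ) (z : ℝ × ℝ) : ℂ :=
  (1 / R : ℂ) * lap v z - advV v z - dy p z

/-- Smooth, `x`-periodic, divergence free fields `(u, v)` that are tangential to the walls `y = 0, 1`
and have no net flux through the channel; equivalently, the fields `(-ψ_y, ψ_x)` of a smooth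
`x`-periodic stream function `ψ` that vanishes on both walls. -/
structure IsSmoothSolenoidal (ℓ : ℝ) (u v : ℝ × ℝ → ℂ) : Prop where
  smooth_u : ContDiff ℝ ∞ u
  smooth_v : ContDiff ℝ ∞ v
  periodic_u : ∀ x y : ℝ, u (x + ℓ, y) = u (x, y)
  periodic_v : ∀ x y : ℝ, v (x + ℓ, y) = v (x, y)
  div_free : ∀ x : ℝ, ∀ y ∈ Set.Icc (0 : ℝ) 1, dx u (x, y) + dy v (x, y) = 0
  wall_zero : ∀ x : ℝ, v (x, 0) = 0
  wall_one : ∀ x : ℝ, v (x, 1) = 0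
  flux_zero : ∀ x : ℝ, ∫ y in (0 : ℝ)..1, u (x, y) = 0

/-- `p` is a pressure of the velocity field `(u, v)`: it solves the Neumann problem
`Δp = -∇·((w·∇)W) - ∇·((W·∇)w)`, `p_y = v_yy / R` on the walls. Its gradient is periodic, and the mean
pressure gradient `c / ℓ` is the one that keeps the flow without net flux; this determines `p` up to
an additive constant. -/
structure IsPressure (ℓ R : ℝ) (u v p : ℝ × ℝ → ℂ) : Prop where
  smooth : ContDiff ℝ ∞ p
  periodic_grad : ∃ c : ℂ, ∀ x y : ℝ, p (x + ℓ, y) = p (x, y) + c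
  poisson : ∀ x : ℝ, ∀ y ∈ Set.Icc (0 : ℝ) 1,
    lap p (x, y) = -(dx (advU u v) (x, y) + dy (advV v) (x, y))
  wall_zero : ∀ x : ℝ, dy p (x, 0) = (1 / R : ℂ) * dy (dy v) (x, 0)
  wall_one : ∀ x : ℝ, dy p (x, 1) = (1 / R : ℂ) * dy (dy v) (x, 1)
  flux_zero : ∀ x : ℝ, ∫ y in (0 : ℝ)..1, rhsU R u v p (x, y) = 0

/-- Lebesgue measure on the periodicity cell `Ω = [0, ℓ] × [0, 1]`. -/
def cell (ℓ : ℝ) : Measure (ℝ × ℝ) :=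
  (volume : Measure (ℝ × ℝ)).restrict (Set.Icc 0 ℓ ×ˢ Set.Icc 0 1)

/-- The Hilbert space `L₂(Ω; ℂ²)`. -/
abbrev L2 (ℓ : ℝ) := Lp (EuclideanSpace ℂ (Fin 2)) 2 (cell ℓ)

/-- `h ∈ L₂(Ω; ℂ²)` is the class of the vector field `(u, v)`. -/
def Represents (ℓ : ℝ) (h : L2 ℓ) (u v : ℝ × ℝ → ℂ) : Prop :=
  ⇑h =ᵐ[cell ℓ] fun z => !₂[u z, v z]

/-- The state space: the closure in `L₂(Ω; ℂ²)` of the smooth solenoidal fields. -/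
def solenoidal (ℓ : ℝ) : Submodule ℂ (L2 ℓ) :=
  (Submodule.span ℂ
    {h : L2 ℓ | ∃ u v, IsSmoothSolenoidal ℓ u v ∧ Represents ℓ h u v}).topologicalClosure

/-- The graph of the operator `w ↦ (1/R) Δw - (w · ∇) W - (W · ∇) w - ∇p` on the smooth solenoidal
fields `w = (u, v)` that vanish on the walls. -/
def classicalGraph (ℓ R : ℝ) : Set (solenoidal ℓ × solenoidal ℓ) :=
  {q | ∃ u v p, IsSmoothSolenoidal ℓ u v ∧
      (∀ x : ℝ, u (x, 0) = 0) ∧ (∀ x : ℝ, u (x, 1) = 0) ∧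
      IsPressure ℓ R u v p ∧
      Represents ℓ q.1 u v ∧ Represents ℓ q.2 (rhsU R u v p) (rhsV R v p)}

/-- The graph of the operator `L_R`, the closure in `L₂` of the classical operator. -/
def operatorGraph (ℓ R : ℝ) : Set (solenoidal ℓ × solenoidal ℓ) :=
  closure (classicalGraph ℓ R)

/-- `S = (s I - L)⁻¹` for the operator `L` with graph `A`: for all `h`, the vector `w = S h` is the one
and only `w` in the domain of `L` with `s w - L w = h`. -/
def IsResolvent {X : Type*} [NormedAddCommGroup X] [NormedSpace ℂ X]
    (A : Set (X × X)) (s : ℂ) (S : X →L[ℂ] X) : Prop :=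
  ∀ h w : X, S h = w ↔ (w, s • w - h) ∈ A

/-- The wavenumber `2πk/ℓ` of the `k`-th Fourier mode in `x`. -/
def wavenumber (ℓ : ℝ) (k : ℤ) : ℝ := 2 * Real.pi * k / ℓ

/-- `(F, G)` are the coefficients of a single Fourier mode `(F y, G y) e^{iκx}` that is a smooth
solenoidal field. -/
structure IsSolenoidalMode (κ : ℝ) (F G : ℝ → ℂ) : Prop where
  smooth_F : ContDiff ℝ ∞ F
  smooth_G : ContDiff ℝ ∞ G
  div_free : ∀ y ∈ Set.Icc (0 : ℝ) 1, Complex.I * κ * F y + deriv G y = 0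
  wall_zero : G 0 = 0
  wall_one : G 1 = 0
  flux_zero : ∫ y in (0 : ℝ)..1, F y = 0

/-- `ψ` is a solution of the fourth order boundary value problem for the stream function, with
wavenumber `κ`, spectral parameter `s` and forcing `F' - iκG`. -/
structure IsStreamSolution (R κ : ℝ) (s : ℂ) (F G ψ : ℝ → ℂ) : Prop where
  smooth : ContDiff ℝ ∞ ψ
  ode : ∀ y ∈ Set.Icc (0 : ℝ) 1,
    (1 / R : ℂ) * iteratedDeriv 4 ψ y
      - (s + 2 * (κ : ℂ) ^ 2 / R + Complex.I * κ * y) * iteratedDeriv 2 ψ y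
      + (s * (κ : ℂ) ^ 2 + (κ : ℂ) ^ 4 / R + Complex.I * (κ : ℂ) ^ 3 * y) * ψ y
      = deriv F y - Complex.I * κ * G y
  zero_zero : ψ 0 = 0
  zero_one : ψ 1 = 0
  deriv_zero : deriv ψ 0 = 0
  deriv_one : deriv ψ 1 = 0

/-- The squared norm `‖f‖² = ∫₀¹ |f|² dy`. -/
def normSq (f : ℝ → ℂ) : ℝ := ∫ y in (0 : ℝ)..1, ‖f y‖ ^ 2

end Couette

end

noncomputable section

namespace Couette

/-! A linear operator whose graph satisfies `‖w‖ ≤ M ‖s w - L w‖`, and for which `s - L` has dense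
range, has a closure with a resolvent at `s` of norm at most `M` (`exists_isResolvent_closure`).
Both conditions are checked on smooth fields, where the Fourier expansion in `x` reduces them to the
boundary value problem for the stream function.

Estimate. For a classical `w = (u, v)` put `f = s w - L w`. The pressure is chosen exactly so that
`f` is again solenoidal: the Poisson equation makes it divergence free, the Neumann condition makes
it tangential, and the mean gradient removes its flux. The `k`-th mode of `w` is `(-ψ', iκψ)`, and
taking the curl of the mode equations eliminates the pressure and leaves the fourth order equation
for `ψ`, forced by the mode of `f` (`exists_stream_of_classical`). The two assumed bounds add up to
a bound on the mode of `w` with constant `2CR²`, and Parseval's identity sums this over `k`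
(`StreamEstimate.norm_sq_le`).

Dense range. With zero forcing the assumed bounds give uniqueness for the boundary value problem.
For a linear ODE, uniqueness implies solvability, by a two-parameter shooting argument
(`exists_stream_solution`). From the stream function one recovers the velocity, and the pressure
exists because the stream equation says that the remaining gradient field is curl free
(`exists_pressure_of_stream`). So every single solenoidal mode lies in the range of `s - L`. Finite
sums of modes are dense in the state space, by Parseval again (`IsSmoothSolenoidal.mem_closure`). -/

/-- A submodule of `X × X` on which `s w - z` controls `w` and has dense range is a core of an
operator whose closure has a resolvent at `s`. -/
theorem exists_isResolvent_closure {X : Type*} [NormedAddCommGroup X] [NormedSpace ℂ X]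
    [CompleteSpace X] (A : Submodule ℂ (X × X)) (s : ℂ) {M : ℝ} (hM : 0 ≤ M)
    (hb : ∀ q ∈ A, ‖q.1‖ ≤ M * ‖s • q.1 - q.2‖)
    (hd : Dense {h : X | ∃ q ∈ A, s • q.1 - q.2 = h}) :
    ∃ S : X →L[ℂ] X, IsResolvent (closure (A : Set (X × X))) s S ∧ ‖S‖ ≤ M := by
  let B : Submodule ℂ (X × X) := A.topologicalClosure
  have hBc : IsClosed (B : Set (X × X)) := A.isClosed_topologicalClosure
  have : CompleteSpace B := hBc.completeSpace_coe
  let T₀ : X × X →L[ℂ] X := s • ContinuousLinearMap.fst ℂ X X - ContinuousLinearMap.snd ℂ X X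
  let T : B →L[ℂ] X := T₀.comp B.subtypeL
  have hT : ∀ q : B, T q = s • q.1.1 - q.1.2 := fun q => rfl
  -- The bound is a closed condition on the pair, so it survives passage to the closure of the
  -- graph.
  have hbB : ∀ q ∈ B, ‖q.1‖ ≤ M * ‖s • q.1 - q.2‖ := by
    intro q hq
    have hcl : IsClosed {q : X × X | ‖q.1‖ ≤ M * ‖s • q.1 - q.2‖} :=
      isClosed_le (by fun_prop) (by fun_prop)
    exact closure_minimal (fun q hq => hb q hq) hcl hq
  -- The image `T q` controls both components of the pair: the first with constant `M`, the second,
  -- which equals `s w - T q`, with constant `‖s‖ M + 1`. Their sum dominates the maximum norm of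
  -- the product.
  let K : NNReal := ⟨M + (‖s‖ * M + 1), by positivity⟩
  have hanti : AntilipschitzWith K T := by
    refine ContinuousLinearMap.antilipschitz_of_bound T fun q => ?_
    have h1 := hbB q.1 q.2
    rw [← hT] at h1
    have h2 : ‖q.1.2‖ ≤ (‖s‖ * M + 1) * ‖T q‖ := by
      have : q.1.2 = s • q.1.1 - T q := by rw [hT]; abel
      calc ‖q.1.2‖ ≤ ‖s • q.1.1‖ + ‖T q‖ := by rw [this]; exact norm_sub_le _ _
        _ ≤ ‖s‖ * (M * ‖T q‖) + ‖T q‖ := by rw [norm_smul]; gcongr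
        _ = _ := by ring
    have h3 : 0 ≤ M * ‖T q‖ := by positivity
    have h4 : 0 ≤ (‖s‖ * M + 1) * ‖T q‖ := by positivity
    change ‖q.1‖ ≤ (M + (‖s‖ * M + 1)) * ‖T q‖
    rw [Prod.norm_def, add_mul]
    exact max_le (by linarith) (by linarith)
  -- A map bounded below on a complete space has closed range, and this range is also dense.
  have hrange : Set.range T = Set.univ := by
    rw [← (hanti.isClosed_range T.uniformContinuous).closure_eq]
    refine Dense.closure_eq (hd.mono ?_)
    rintro h ⟨q, hq, rfl⟩
    exact ⟨⟨q, A.le_topologicalClosure hq⟩, rfl⟩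
  let e : B ≃ₗ[ℂ] X := LinearEquiv.ofBijective T.toLinearMap
    ⟨hanti.injective, Set.range_eq_univ.mp hrange⟩
  have he : ∀ q, e q = T q := fun q => rfl
  let S : X →L[ℂ] X :=
    ((LinearMap.fst ℂ X X).comp (B.subtype.comp e.symm.toLinearMap)).mkContinuous M (by
      intro h
      have := hbB (e.symm h).1 (e.symm h).2
      rw [← hT, ← he, e.apply_symm_apply] at this
      exact this)
  have hS : ∀ h, S h = (e.symm h).1.1 := fun h => rfl
  refine ⟨S, fun h w => ?_, LinearMap.mkContinuous_norm_le _ hM _⟩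
  change _ ↔ (w, s • w - h) ∈ B
  constructor
  · rintro rfl
    have h1 : s • (e.symm h).1.1 - (e.symm h).1.2 = h := by
      rw [← hT, ← he, e.apply_symm_apply]
    have h2 : (S h, s • S h - h) = (e.symm h).1 := by
      rw [hS]
      refine Prod.ext rfl ?_
      change s • (e.symm h).1.1 - h = (e.symm h).1.2
      rw [sub_eq_iff_eq_add, add_comm, ← sub_eq_iff_eq_add, h1]
    rw [h2]
    exact (e.symm h).2
  · intro hw
    have : e ⟨_, hw⟩ = h := by rw [he, hT]; simp
    rw [hS, ← this, e.symm_apply_apply]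

/-! ### Global solvability of linear ODEs by the Picard series. -/

section LinearODE

variable {E : Type*} [NormedAddCommGroup E] [NormedSpace ℝ E]

/-- The terms of the Picard series of the linear equation `Φ' = A Φ + b`, `Φ 0 = x₀`. -/
def picardTerm (A : ℝ → E →L[ℝ] E) (b : ℝ → E) (x₀ : E) : ℕ → ℝ → E
  | 0, t => x₀ + ∫ τ in (0 : ℝ)..t, b τ
  | n + 1, t => ∫ τ in (0 : ℝ)..t, A τ (picardTerm A b x₀ n τ)

variable {A : ℝ → E →L[ℝ] E} {b : ℝ → E}

theorem continuous_picardTerm (hA : Continuous A) (hb : Continuous b) (x₀ : E) (n : ℕ) :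
    Continuous (picardTerm A b x₀ n) := by
  induction n with
  | zero =>
    exact continuous_const.add
      (intervalIntegral.continuous_primitive (fun _ _ => hb.intervalIntegrable _ _) 0)
  | succ n ih =>
    exact intervalIntegral.continuous_primitive
      (fun _ _ => (hA.clm_apply ih).intervalIntegrable _ _) 0

/-- Each iteration costs a factor `K` and one integration of `|τ| ^ n`. The resulting factorial
makes the series converge on every bounded interval, so no small time step is needed. -/
theorem norm_picardTerm_le {x₀ : E} {T K B : ℝ} (hK : ∀ t, |t| ≤ T → ‖A t‖ ≤ K)
    (hB : ∀ t, |t| ≤ T → ‖picardTerm A b x₀ 0 t‖ ≤ B) (hA : Continuous A) (hb : Continuous b)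
    (n : ℕ) : ∀ t, |t| ≤ T → ‖picardTerm A b x₀ n t‖ ≤ B * (K ^ n * |t| ^ n / n.factorial) := by
  induction n with
  | zero => intro t ht; simpa using hB t ht
  | succ n ih =>
    intro t ht
    have hmem : ∀ τ ∈ Set.uIoc 0 t, |τ| ≤ T := fun τ hτ => by
      have := Set.abs_sub_left_of_mem_uIcc (Set.uIoc_subset_uIcc hτ)
      simp only [sub_zero] at this
      exact this.trans ht
    have hK0 : 0 ≤ K := (norm_nonneg _).trans (hK t ht)
    calc ‖picardTerm A b x₀ (n + 1) t‖
        ≤ ∫ τ in Set.uIoc 0 t, ‖A τ (picardTerm A b x₀ n τ)‖ :=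
          intervalIntegral.norm_integral_le_integral_norm_uIoc
      _ ≤ ∫ τ in Set.uIoc 0 t, (K * (B * K ^ n / n.factorial)) * |τ - 0| ^ n := by
          refine setIntegral_mono_on ?_ ?_ measurableSet_uIoc fun τ hτ => ?_
          · exact (((hA.clm_apply (continuous_picardTerm hA hb x₀ n)).norm).intervalIntegrable
              0 t).def'
          · exact ((Continuous.intervalIntegrable (by fun_prop) 0 t).def')
          · calc ‖A τ (picardTerm A b x₀ n τ)‖ ≤ ‖A τ‖ * ‖picardTerm A b x₀ n τ‖ :=
                  (A τ).le_opNorm _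
              _ ≤ K * (B * (K ^ n * |τ| ^ n / n.factorial)) := by
                  gcongr
                  exacts [hK τ (hmem τ hτ), ih τ (hmem τ hτ)]
              _ = _ := by rw [sub_zero]; ring
      _ = _ := by
          rw [integral_const_mul, integral_pow_abs_sub_uIoc, Nat.factorial_succ]
          push_cast
          rw [sub_zero]
          field_simp
          ring

/-- Linear differential equations with continuous coefficients on the line have global solutions. -/
theorem exists_solution_linear_ode [CompleteSpace E] (hA : Continuous A) (hb : Continuous b)
    (x₀ : E) : ∃ Φ : ℝ → E, Φ 0 = x₀ ∧ ∀ t, HasDerivAt Φ (A t (Φ t) + b t) t := by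
  set φ := picardTerm A b x₀ with hφ
  have hφc : ∀ n, Continuous (φ n) := continuous_picardTerm hA hb x₀
  -- A summable majorant on each `[-T, T]`, as for the Weierstrass test.
  have hbound : ∀ T : ℝ, ∃ K : ℝ, ∃ u : ℕ → ℝ, Summable u ∧
      (∀ t, |t| ≤ T → ‖A t‖ ≤ K) ∧ ∀ n t, |t| ≤ T → ‖φ n t‖ ≤ u n := by
    intro T
    obtain ⟨K, hK⟩ := isCompact_Icc.exists_bound_of_continuousOn (s := Set.Icc (-T) T)
      hA.continuousOn
    obtain ⟨B, hB⟩ := isCompact_Icc.exists_bound_of_continuousOn (s := Set.Icc (-T) T)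
      (hφc 0).continuousOn
    have hK' : ∀ t, |t| ≤ T → ‖A t‖ ≤ K := fun t ht => hK t (abs_le.mp ht)
    have hB' : ∀ t, |t| ≤ T → ‖φ 0 t‖ ≤ B := fun t ht => hB t (abs_le.mp ht)
    refine ⟨K, fun n => B * ((K * T) ^ n / n.factorial),
      (Real.summable_pow_div_factorial _).mul_left _, hK', fun n t ht => ?_⟩
    refine (norm_picardTerm_le hK' hB' hA hb n t ht).trans ?_
    have hK0 : 0 ≤ K := (norm_nonneg _).trans (hK' t ht)
    have hB0 : 0 ≤ B := (norm_nonneg _).trans (hB' t ht)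
    simp only [mul_pow]
    gcongr
  set Φ : ℝ → E := fun t => ∑' n, φ n t with hΦ
  have hsum : ∀ t, Summable fun n => φ n t := fun t => by
    obtain ⟨K, u, hu, -, h⟩ := hbound |t|
    exact Summable.of_norm_bounded hu fun n => h n t le_rfl
  have hΦc : Continuous Φ := by
    refine continuous_iff_continuousAt.mpr fun t => ?_
    obtain ⟨K, u, hu, -, h⟩ := hbound (|t| + 1)
    have hon : ContinuousOn Φ {τ | |τ| ≤ |t| + 1} :=
      continuousOn_tsum (fun n => (hφc n).continuousOn) hu fun n τ hτ => h n τ hτ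
    refine hon.continuousAt (Filter.mem_of_superset
      ((isOpen_lt continuous_abs continuous_const).mem_nhds (by simp : |t| < |t| + 1))
      fun τ hτ => (show |τ| < |t| + 1 from hτ).le)
  -- Integrating `A Φ` term by term shifts the series by one index, so only the zeroth term is left
  -- over.
  have hint : ∀ t, Φ t = (x₀ + ∫ τ in (0 : ℝ)..t, b τ) + ∫ τ in (0 : ℝ)..t, A τ (Φ τ) := by
    intro t
    obtain ⟨K, u, hu, hK, h⟩ := hbound |t|
    have hmem : ∀ τ ∈ Set.uIoc 0 t, |τ| ≤ |t| := fun τ hτ => by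
      simpa using Set.abs_sub_left_of_mem_uIcc (Set.uIoc_subset_uIcc hτ)
    have hK0 : 0 ≤ K := (norm_nonneg _).trans (hK t le_rfl)
    have hs : HasSum (fun n => ∫ τ in (0 : ℝ)..t, A τ (φ n τ)) (∫ τ in (0 : ℝ)..t, A τ (Φ τ)) := by
      refine intervalIntegral.hasSum_integral_of_dominated_convergence (fun n _ => K * u n)
        (fun n => (hA.clm_apply (hφc n)).aestronglyMeasurable)
        (fun n => Filter.Eventually.of_forall fun τ hτ => ?_)
        (Filter.Eventually.of_forall fun τ hτ => hu.mul_left K)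
        intervalIntegrable_const
        (Filter.Eventually.of_forall fun τ hτ => ((A τ).hasSum (hsum τ).hasSum))
      refine ((A τ).le_opNorm _).trans ?_
      gcongr
      exacts [hK τ (hmem τ hτ), h n τ (hmem τ hτ)]
    have := (hsum t).tsum_eq_zero_add
    rw [hΦ]
    simp only
    rw [this, ← hs.tsum_eq]
    rfl
  refine ⟨Φ, by rw [hint]; simp, fun t => ?_⟩
  have h1 : HasDerivAt (fun t => (x₀ + ∫ τ in (0 : ℝ)..t, b τ) + ∫ τ in (0 : ℝ)..t, A τ (Φ τ))
      (b t + A t (Φ t)) t :=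
    ((hb.integral_hasStrictDerivAt 0 t).hasDerivAt.const_add x₀).add
      ((hA.clm_apply hΦc).integral_hasStrictDerivAt 0 t).hasDerivAt
  rw [add_comm, show Φ = _ from funext hint]
  simpa only [← hint] using h1

end LinearODE

/-! ### Partial derivatives -/

theorem contDiff_dx {f : ℝ × ℝ → ℂ} (hf : ContDiff ℝ ∞ f) : ContDiff ℝ ∞ (dx f) :=
  (hf.fderiv_right (m := ∞) (by simp)).clm_apply contDiff_const

theorem contDiff_dy {f : ℝ × ℝ → ℂ} (hf : ContDiff ℝ ∞ f) : ContDiff ℝ ∞ (dy f) :=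
  (hf.fderiv_right (m := ∞) (by simp)).clm_apply contDiff_const

theorem hasDerivAt_fst {f : ℝ × ℝ → ℂ} (hf : ContDiff ℝ ∞ f) (x y : ℝ) :
    HasDerivAt (fun x => f (x, y)) (dx f (x, y)) x :=
  ((hf.differentiable (by simp)) (x, y)).hasFDerivAt.comp_hasDerivAt x
    ((hasDerivAt_id x).prodMk (hasDerivAt_const x y))

theorem hasDerivAt_snd {f : ℝ × ℝ → ℂ} (hf : ContDiff ℝ ∞ f) (x y : ℝ) :
    HasDerivAt (fun y => f (x, y)) (dy f (x, y)) y :=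
  ((hf.differentiable (by simp)) (x, y)).hasFDerivAt.comp_hasDerivAt y
    ((hasDerivAt_const y x).prodMk (hasDerivAt_id y))

theorem dx_dy_comm {f : ℝ × ℝ → ℂ} (hf : ContDiff ℝ ∞ f) : dx (dy f) = dy (dx f) := by
  funext z
  have hd : DifferentiableAt ℝ (fderiv ℝ f) z :=
    ((hf.fderiv_right (m := ∞) (by simp)).differentiable (by simp)) z
  have h1 : dx (dy f) z = fderiv ℝ (fderiv ℝ f) z (1, 0) (0, 1) := by
    unfold dx dy
    rw [fderiv_clm_apply hd (differentiableAt_const _)]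
    simp
  have h2 : dy (dx f) z = fderiv ℝ (fderiv ℝ f) z (0, 1) (1, 0) := by
    unfold dx dy
    rw [fderiv_clm_apply hd (differentiableAt_const _)]
    simp
  rw [h1, h2]
  exact hf.contDiffAt.isSymmSndFDerivAt
    (by simpa using WithTop.coe_le_coe.mpr (le_top (a := (2 : ℕ∞)))) _ _

/-- The increment `c` is there for the pressure, which need not be periodic although its gradient
is. Velocities use `c = 0`. -/
theorem dx_periodic {ℓ : ℝ} {c : ℂ} {f : ℝ × ℝ → ℂ} (hf : ContDiff ℝ ∞ f)
    (hper : ∀ x y, f (x + ℓ, y) = f (x, y) + c) (x y : ℝ) : dx f (x + ℓ, y) = dx f (x, y) := by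
  have h1 := (hasDerivAt_fst hf (x + ℓ) y).comp_add_const x ℓ
  have h2 := (hasDerivAt_fst hf x y).add_const c
  simp only [hper] at h1
  exact h1.unique h2

theorem dy_periodic {ℓ : ℝ} {c : ℂ} {f : ℝ × ℝ → ℂ} (hf : ContDiff ℝ ∞ f)
    (hper : ∀ x y, f (x + ℓ, y) = f (x, y) + c) (x y : ℝ) : dy f (x + ℓ, y) = dy f (x, y) := by
  have h1 := hasDerivAt_snd hf (x + ℓ) y
  have h2 := (hasDerivAt_snd hf x y).add_const c
  simp only [hper] at h1
  exact h1.unique h2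

/-! ### Fourier coefficients in `x` -/

/-- The exponential `e^{iκx}` of the `k`-th mode. -/
def modeExp (ℓ : ℝ) (k : ℤ) (x : ℝ) : ℂ := Complex.exp (Complex.I * wavenumber ℓ k * x)

/-- The `k`-th Fourier coefficient in `x`, as a function of `y`. -/
def modeCoeff (ℓ : ℝ) (k : ℤ) (f : ℝ × ℝ → ℂ) (y : ℝ) : ℂ :=
  (ℓ : ℂ)⁻¹ * ∫ x in (0 : ℝ)..ℓ, modeExp ℓ (-k) x * f (x, y)

theorem wavenumber_neg (ℓ : ℝ) (k : ℤ) : wavenumber ℓ (-k) = -wavenumber ℓ k := by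
  simp only [wavenumber]; push_cast; ring

theorem contDiff_modeExp (ℓ : ℝ) (k : ℤ) : ContDiff ℝ ∞ (modeExp ℓ k) := by
  unfold modeExp
  exact (contDiff_const.mul Complex.ofRealCLM.contDiff).cexp

theorem continuous_modeExp (ℓ : ℝ) (k : ℤ) : Continuous (modeExp ℓ k) :=
  (contDiff_modeExp ℓ k).continuous

theorem hasDerivAt_modeExp (ℓ : ℝ) (k : ℤ) (x : ℝ) :
    HasDerivAt (modeExp ℓ k) (Complex.I * wavenumber ℓ k * modeExp ℓ k x) x := by
  have := ((hasDerivAt_id x).ofReal_comp.const_mul (Complex.I * wavenumber ℓ k)).cexp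
  simp only [id_eq, Complex.ofReal_one, mul_one] at this
  exact this.congr_deriv (mul_comm (modeExp ℓ k x) _)

theorem modeExp_add_period {ℓ : ℝ} (hℓ : 0 < ℓ) (k : ℤ) (x : ℝ) :
    modeExp ℓ k (x + ℓ) = modeExp ℓ k x := by
  unfold modeExp
  have : Complex.I * wavenumber ℓ k * ((x + ℓ : ℝ) : ℂ)
      = Complex.I * wavenumber ℓ k * x + k * (2 * Real.pi * Complex.I) := by
    have : (ℓ : ℂ) ≠ 0 := by exact_mod_cast hℓ.ne'
    simp only [wavenumber]
    push_cast
    field_simp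
  rw [this, Complex.exp_add, Complex.exp_int_mul_two_pi_mul_I, mul_one]

theorem modeExp_add (ℓ : ℝ) (j k : ℤ) (x : ℝ) :
    modeExp ℓ (j + k) x = modeExp ℓ j x * modeExp ℓ k x := by
  simp only [modeExp, ← Complex.exp_add, wavenumber]
  congr 1
  push_cast
  ring

theorem norm_modeExp (ℓ : ℝ) (k : ℤ) (x : ℝ) : ‖modeExp ℓ k x‖ = 1 := by
  have : Complex.I * wavenumber ℓ k * x = ((wavenumber ℓ k * x : ℝ) : ℂ) * Complex.I := by
    push_cast; ring
  rw [modeExp, this, Complex.norm_exp_ofReal_mul_I]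

section Calculus

variable {ℓ : ℝ} {k : ℤ} {f g : ℝ × ℝ → ℂ}

theorem intervalIntegrable_modeExp_mul (hf : Continuous f) (a b y : ℝ) :
    IntervalIntegrable (fun x => modeExp ℓ k x * f (x, y)) volume a b :=
  ((continuous_modeExp ℓ k).mul (by fun_prop)).intervalIntegrable _ _

theorem modeCoeff_add (hf : Continuous f) (hg : Continuous g) (y : ℝ) :
    modeCoeff ℓ k (fun z => f z + g z) y = modeCoeff ℓ k f y + modeCoeff ℓ k g y := by
  simp only [modeCoeff, mul_add]
  rw [intervalIntegral.integral_add (intervalIntegrable_modeExp_mul hf _ _ _)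
    (intervalIntegrable_modeExp_mul hg _ _ _), mul_add]

theorem modeCoeff_sub (hf : Continuous f) (hg : Continuous g) (y : ℝ) :
    modeCoeff ℓ k (fun z => f z - g z) y = modeCoeff ℓ k f y - modeCoeff ℓ k g y := by
  simp only [modeCoeff, mul_sub]
  rw [intervalIntegral.integral_sub (intervalIntegrable_modeExp_mul hf _ _ _)
    (intervalIntegrable_modeExp_mul hg _ _ _), mul_sub]

theorem modeCoeff_mul_left (c : ℝ → ℂ) (f : ℝ × ℝ → ℂ) (y : ℝ) :
    modeCoeff ℓ k (fun z => c z.2 * f z) y = c y * modeCoeff ℓ k f y := by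
  simp only [modeCoeff]
  rw [mul_left_comm, ← intervalIntegral.integral_const_mul (c y)]
  congr 2
  funext x
  ring

theorem modeCoeff_congr {y : ℝ} (h : ∀ x, f (x, y) = g (x, y)) :
    modeCoeff ℓ k f y = modeCoeff ℓ k g y := by
  simp only [modeCoeff, h]

theorem modeCoeff_eq_zero {y : ℝ} (h : ∀ x, f (x, y) = 0) : modeCoeff ℓ k f y = 0 := by
  simp [modeCoeff, h]

theorem hasDerivAt_modeCoeff (hf : ContDiff ℝ ∞ f) (y : ℝ) :
    HasDerivAt (modeCoeff ℓ k f) (modeCoeff ℓ k (dy f) y) y := by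
  -- Differentiation under the integral: near `y`, the integrand's derivative is dominated by the
  -- maximum `B` of `dy f` on a compact set, since the exponential has modulus one.
  have hcd := (contDiff_dy hf).continuous
  obtain ⟨B, hB⟩ := ((isCompact_uIcc (a := (0 : ℝ)) (b := ℓ)).prod
    (isCompact_closedBall y 1)).exists_bound_of_continuousOn hcd.continuousOn
  refine HasDerivAt.const_mul _ (intervalIntegral.hasDerivAt_integral_of_dominated_loc_of_deriv_le
    (F := fun y x => modeExp ℓ (-k) x * f (x, y))
    (F' := fun y x => modeExp ℓ (-k) x * dy f (x, y)) (bound := fun _ => B)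
    (Metric.closedBall_mem_nhds y one_pos) ?_ ?_ ?_ ?_ ?_ ?_).2
  · exact Filter.Eventually.of_forall fun y =>
      ((continuous_modeExp ℓ (-k)).mul (by fun_prop)).aestronglyMeasurable
  · exact intervalIntegrable_modeExp_mul hf.continuous _ _ _
  · exact ((continuous_modeExp ℓ (-k)).mul (by fun_prop)).aestronglyMeasurable
  · refine Filter.Eventually.of_forall fun x hx t ht => ?_
    rw [norm_mul, norm_modeExp, one_mul]
    exact hB (x, t) ⟨Set.uIoc_subset_uIcc hx, ht⟩
  · exact intervalIntegrable_const
  · exact Filter.Eventually.of_forall fun x hx t ht => (hasDerivAt_snd hf x t).const_mul _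

theorem deriv_modeCoeff (hf : ContDiff ℝ ∞ f) :
    deriv (modeCoeff ℓ k f) = modeCoeff ℓ k (dy f) :=
  funext fun y => (hasDerivAt_modeCoeff hf y).deriv

theorem contDiff_modeCoeff (hf : ContDiff ℝ ∞ f) : ContDiff ℝ ∞ (modeCoeff ℓ k f) := by
  rw [contDiff_infty]
  intro n
  induction n generalizing f with
  | zero =>
    exact contDiff_zero.mpr (continuous_iff_continuousAt.mpr fun y =>
      (hasDerivAt_modeCoeff hf y).continuousAt)
  | succ n ih =>
    push_cast
    rw [contDiff_succ_iff_deriv]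
    refine ⟨fun y => (hasDerivAt_modeCoeff hf y).differentiableAt, by simp, ?_⟩
    rw [deriv_modeCoeff hf]
    exact ih (contDiff_dy hf)

theorem modeCoeff_dx (hℓ : 0 < ℓ) (hf : ContDiff ℝ ∞ f) (hper : ∀ x y, f (x + ℓ, y) = f (x, y))
    (y : ℝ) : modeCoeff ℓ k (dx f) y = Complex.I * wavenumber ℓ k * modeCoeff ℓ k f y := by
  have hi1 := intervalIntegrable_modeExp_mul (ℓ := ℓ) (k := -k) hf.continuous 0 ℓ y
  have hi2 := intervalIntegrable_modeExp_mul (ℓ := ℓ) (k := -k) (contDiff_dx hf).continuous 0 ℓ y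
  have h := intervalIntegral.integral_eq_sub_of_hasDerivAt (a := 0) (b := ℓ)
    (fun x _ => (hasDerivAt_modeExp ℓ (-k) x).mul (hasDerivAt_fst hf x y))
    (((hi1.const_mul (Complex.I * wavenumber ℓ (-k))).add hi2).congr (by
      intro x _
      simp only
      ring))
  have h0 : modeExp ℓ (-k) ℓ * f (ℓ, y) - modeExp ℓ (-k) 0 * f (0, y) = 0 := by
    have h1 := modeExp_add_period hℓ (-k) 0
    have h2 := hper 0 y
    rw [zero_add] at h1 h2
    rw [h1, h2, sub_self]
  simp only [Pi.mul_apply, mul_assoc] at h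
  rw [h0] at h
  rw [intervalIntegral.integral_add, intervalIntegral.integral_const_mul,
    intervalIntegral.integral_const_mul] at h
  · rw [wavenumber_neg] at h
    push_cast at h
    simp only [modeCoeff]
    linear_combination (ℓ : ℂ)⁻¹ * h
  · exact (hi1.const_mul _).const_mul _
  · exact hi2

theorem integral_modeCoeff_eq_zero (hf : Continuous f)
    (h : ∀ x, ∫ y in (0 : ℝ)..1, f (x, y) = 0) : ∫ y in (0 : ℝ)..1, modeCoeff ℓ k f y = 0 := by
  simp only [modeCoeff]
  rw [intervalIntegral.integral_const_mul, intervalIntegral_intervalIntegral_swap]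
  · simp [h]
  · have hc : Continuous (Function.uncurry fun y x => modeExp ℓ (-k) x * f (x, y)) :=
      ((continuous_modeExp ℓ (-k)).comp continuous_snd).mul (hf.comp (by fun_prop))
    exact (hc.continuousOn.integrableOn_compact (isCompact_uIcc.prod isCompact_uIcc)).mono_set
      (Set.prod_mono Set.uIoc_subset_uIcc Set.uIoc_subset_uIcc)

theorem modeCoeff_mul_modeExp (hℓ : 0 < ℓ) (j : ℤ) (c : ℝ → ℂ) (y : ℝ) :
    modeCoeff ℓ k (fun z => c z.2 * modeExp ℓ j z.1) y = if j = k then c y else 0 := by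
  have hℓ' : (ℓ : ℂ) ≠ 0 := by exact_mod_cast hℓ.ne'
  rw [modeCoeff_mul_left c (fun z => modeExp ℓ j z.1)]
  simp only [modeCoeff, ← modeExp_add]
  split_ifs with hjk
  · subst hjk
    simp [modeExp, wavenumber, hℓ']
  · have hn : (-k + j : ℤ) ≠ 0 := by omega
    have hκ : Complex.I * wavenumber ℓ (-k + j) ≠ 0 := by
      refine mul_ne_zero Complex.I_ne_zero ?_
      have : wavenumber ℓ (-k + j) ≠ 0 := by
        have : ((-k + j : ℤ) : ℝ) ≠ 0 := by exact_mod_cast hn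
        simp only [wavenumber]
        positivity
      exact_mod_cast this
    -- Orthogonality: a nonconstant exponential is a multiple of its own derivative, whose integral
    -- over a period vanishes.
    have h := intervalIntegral.integral_eq_sub_of_hasDerivAt (a := 0) (b := ℓ)
      (fun x _ => hasDerivAt_modeExp ℓ (-k + j) x)
      ((continuous_const.mul (continuous_modeExp ℓ (-k + j))).intervalIntegrable _ _)
    have h1 := modeExp_add_period hℓ (-k + j) 0
    rw [zero_add] at h1
    rw [h1, sub_self, intervalIntegral.integral_const_mul] at h
    rw [(mul_eq_zero.mp h).resolve_left hκ, mul_zero, mul_zero]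

theorem fourierCoeffOn_eq_modeCoeff (hℓ : 0 < ℓ) (f : ℝ × ℝ → ℂ) (k : ℤ) (y : ℝ) :
    fourierCoeffOn hℓ (fun x => f (x, y)) k = modeCoeff ℓ k f y := by
  rw [fourierCoeffOn_eq_integral, modeCoeff, sub_zero, Complex.real_smul]
  push_cast
  rw [one_div]
  congr 2
  funext x
  rw [fourier_coe_apply, smul_eq_mul, modeExp, wavenumber]
  congr 2
  push_cast
  ring

theorem integrable_cell {E : Type*} [NormedAddCommGroup E] {f : ℝ × ℝ → E} (hf : Continuous f) :
    Integrable f (cell ℓ) :=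
  hf.continuousOn.integrableOn_compact (isCompact_Icc.prod isCompact_Icc)

/-- Parseval's identity on the cell. -/
theorem hasSum_normSq_modeCoeff (hℓ : 0 < ℓ) (hf : Continuous f) :
    HasSum (fun k => ℓ * normSq (modeCoeff ℓ k f)) (∫ z, ‖f z‖ ^ 2 ∂cell ℓ) := by
  have hfub : ∫ z, ‖f z‖ ^ 2 ∂cell ℓ
      = ∫ y in (0 : ℝ)..1, ∫ x in (0 : ℝ)..ℓ, ‖f (x, y)‖ ^ 2 := by
    have hint : Integrable (fun z => ‖f z‖ ^ 2) (cell ℓ) := integrable_cell (by fun_prop)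
    rw [cell, Measure.volume_eq_prod, ← Measure.prod_restrict] at hint ⊢
    rw [integral_prod_symm _ hint, intervalIntegral.integral_of_le zero_le_one,
      integral_Icc_eq_integral_Ioc]
    simp only [intervalIntegral.integral_of_le hℓ.le, integral_Icc_eq_integral_Ioc]
  -- Parseval's identity on each horizontal line, to be integrated in `y`.
  have hpt : ∀ y, HasSum (fun k => ℓ * ‖modeCoeff ℓ k f y‖ ^ 2)
      (∫ x in (0 : ℝ)..ℓ, ‖f (x, y)‖ ^ 2) := by
    intro y
    have hmem : MemLp (fun x => f (x, y)) 2 (volume.restrict (Set.Ioc 0 ℓ)) := by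
      rw [memLp_two_iff_integrable_sq_norm (by fun_prop)]
      exact (Continuous.intervalIntegrable (by fun_prop) 0 ℓ).1
    have h := (hasSum_sq_fourierCoeffOn hℓ hmem).mul_left ℓ
    simp only [fourierCoeffOn_eq_modeCoeff, sub_zero, smul_eq_mul] at h
    rwa [mul_inv_cancel_left₀ hℓ.ne'] at h
  have hc : ∀ k, Continuous (modeCoeff ℓ k f) := fun k => by
    unfold modeCoeff
    refine continuous_const.mul
      (intervalIntegral.continuous_parametric_intervalIntegral_of_continuous' ?_ 0 ℓ)
    exact ((continuous_modeExp ℓ (-k)).comp continuous_snd).mul (hf.comp (by fun_prop))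
  have hc2 : Continuous fun y => ∫ x in (0 : ℝ)..ℓ, ‖f (x, y)‖ ^ 2 :=
    intervalIntegral.continuous_parametric_intervalIntegral_of_continuous'
      (by unfold Function.uncurry; fun_prop) 0 ℓ
  rw [hfub]
  -- The terms are nonnegative and serve as their own majorants; by `hpt` the majorants sum to a
  -- continuous function of `y`.
  have := intervalIntegral.hasSum_integral_of_dominated_convergence (μ := volume)
    (a := 0) (b := 1) (F := fun k y => ℓ * ‖modeCoeff ℓ k f y‖ ^ 2)
    (f := fun y => ∫ x in (0 : ℝ)..ℓ, ‖f (x, y)‖ ^ 2)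
    (fun k y => ℓ * ‖modeCoeff ℓ k f y‖ ^ 2)
    (fun k => (continuous_const.mul ((hc k).norm.pow 2)).aestronglyMeasurable)
    (fun k => Filter.Eventually.of_forall fun y _ => by
      rw [Real.norm_of_nonneg (by positivity)])
    (Filter.Eventually.of_forall fun y _ => (hpt y).summable)
    (by simp only [fun y => (hpt y).tsum_eq]; exact hc2.intervalIntegrable _ _)
    (Filter.Eventually.of_forall fun y _ => hpt y)
  simpa only [intervalIntegral.integral_const_mul, normSq] using this

end Calculus

/-! ### The boundary value problem for the stream function -/

/-- `ψ₀'''' = α ψ₀'' + β ψ₀ + f` on the whole line, with the first three derivatives named. -/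
structure IsFourthOrderSolution (α β f ψ₀ ψ₁ ψ₂ ψ₃ : ℝ → ℂ) : Prop where
  hasDerivAt₀ : ∀ y, HasDerivAt ψ₀ (ψ₁ y) y
  hasDerivAt₁ : ∀ y, HasDerivAt ψ₁ (ψ₂ y) y
  hasDerivAt₂ : ∀ y, HasDerivAt ψ₂ (ψ₃ y) y
  hasDerivAt₃ : ∀ y, HasDerivAt ψ₃ (α y * ψ₂ y + β y * ψ₀ y + f y) y

namespace IsFourthOrderSolution

variable {α β f g ψ₀ ψ₁ ψ₂ ψ₃ φ₀ φ₁ φ₂ φ₃ : ℝ → ℂ}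

theorem add_const_mul (hψ : IsFourthOrderSolution α β f ψ₀ ψ₁ ψ₂ ψ₃)
    (hφ : IsFourthOrderSolution α β g φ₀ φ₁ φ₂ φ₃) (c : ℂ) :
    IsFourthOrderSolution α β (fun y => f y + c * g y) (fun y => ψ₀ y + c * φ₀ y)
      (fun y => ψ₁ y + c * φ₁ y) (fun y => ψ₂ y + c * φ₂ y) (fun y => ψ₃ y + c * φ₃ y) where
  hasDerivAt₀ y := (hψ.hasDerivAt₀ y).add ((hφ.hasDerivAt₀ y).const_mul c)
  hasDerivAt₁ y := (hψ.hasDerivAt₁ y).add ((hφ.hasDerivAt₁ y).const_mul c)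
  hasDerivAt₂ y := (hψ.hasDerivAt₂ y).add ((hφ.hasDerivAt₂ y).const_mul c)
  hasDerivAt₃ y := by
    refine ((hψ.hasDerivAt₃ y).add ((hφ.hasDerivAt₃ y).const_mul c)).congr_deriv ?_
    ring

/-- Bootstrapping: if all four functions are `C^n`, so are their derivatives, by the equation. -/
theorem contDiff (h : IsFourthOrderSolution α β f ψ₀ ψ₁ ψ₂ ψ₃) (hα : ContDiff ℝ ∞ α)
    (hβ : ContDiff ℝ ∞ β) (hf : ContDiff ℝ ∞ f) : ContDiff ℝ ∞ ψ₀ := by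
  have key : ∀ n : ℕ, ContDiff ℝ n ψ₀ ∧ ContDiff ℝ n ψ₁ ∧ ContDiff ℝ n ψ₂ ∧ ContDiff ℝ n ψ₃ := by
    intro n
    induction n with
    | zero =>
      simp only [Nat.cast_zero, contDiff_zero]
      exact ⟨continuous_iff_continuousAt.mpr fun y => (h.hasDerivAt₀ y).continuousAt,
        continuous_iff_continuousAt.mpr fun y => (h.hasDerivAt₁ y).continuousAt,
        continuous_iff_continuousAt.mpr fun y => (h.hasDerivAt₂ y).continuousAt,
        continuous_iff_continuousAt.mpr fun y => (h.hasDerivAt₃ y).continuousAt⟩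
    | succ n ih =>
      have step : ∀ {u v : ℝ → ℂ}, (∀ y, HasDerivAt u (v y) y) → ContDiff ℝ n v →
          ContDiff ℝ (n + 1 : ℕ) u := by
        intro u v huv hv
        push_cast
        rw [contDiff_succ_iff_deriv]
        refine ⟨fun y => (huv y).differentiableAt, by simp, ?_⟩
        rwa [show deriv u = v from funext fun y => (huv y).deriv]
      obtain ⟨h0, h1, h2, h3⟩ := ih
      refine ⟨step h.hasDerivAt₀ h1, step h.hasDerivAt₁ h2, step h.hasDerivAt₂ h3,
        step h.hasDerivAt₃ ?_⟩
      exact (((contDiff_infty.mp hα n).mul h2).add ((contDiff_infty.mp hβ n).mul h0)).add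
        (contDiff_infty.mp hf n)
  exact contDiff_infty.mpr fun n => (key n).1

theorem deriv_eq (h : IsFourthOrderSolution α β f ψ₀ ψ₁ ψ₂ ψ₃) : deriv ψ₀ = ψ₁ :=
  funext fun y => (h.hasDerivAt₀ y).deriv

theorem iteratedDeriv_two (h : IsFourthOrderSolution α β f ψ₀ ψ₁ ψ₂ ψ₃) :
    iteratedDeriv 2 ψ₀ = ψ₂ := by
  rw [iteratedDeriv_succ', h.deriv_eq, iteratedDeriv_one]
  exact funext fun y => (h.hasDerivAt₁ y).deriv

theorem iteratedDeriv_four (h : IsFourthOrderSolution α β f ψ₀ ψ₁ ψ₂ ψ₃) (y : ℝ) :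
    iteratedDeriv 4 ψ₀ y = α y * ψ₂ y + β y * ψ₀ y + f y := by
  rw [iteratedDeriv_succ, iteratedDeriv_succ, h.iteratedDeriv_two,
    show deriv ψ₂ = ψ₃ from funext fun y => (h.hasDerivAt₂ y).deriv]
  exact (h.hasDerivAt₃ y).deriv

/-- The equation is a first order system in `(ψ, ψ', ψ'', ψ''')`. The two boundary conditions at `0`
are built in, and the free values `a`, `b` are the shooting parameters. -/
theorem exists_of_initial_values (hα : Continuous α) (hβ : Continuous β) (hf : Continuous f)
    (a b : ℂ) : ∃ ψ₀ ψ₁ ψ₂ ψ₃, IsFourthOrderSolution α β f ψ₀ ψ₁ ψ₂ ψ₃ ∧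
      ψ₀ 0 = 0 ∧ ψ₁ 0 = 0 ∧ ψ₂ 0 = a ∧ ψ₃ 0 = b := by
  let p₀ : ℂ × ℂ × ℂ × ℂ →L[ℝ] ℂ := ContinuousLinearMap.fst ℝ ℂ (ℂ × ℂ × ℂ)
  let q₁ : ℂ × ℂ × ℂ × ℂ →L[ℝ] ℂ × ℂ × ℂ := ContinuousLinearMap.snd ℝ ℂ (ℂ × ℂ × ℂ)
  let p₁ := (ContinuousLinearMap.fst ℝ ℂ (ℂ × ℂ)).comp q₁
  let q₂ := (ContinuousLinearMap.snd ℝ ℂ (ℂ × ℂ)).comp q₁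
  let p₂ := (ContinuousLinearMap.fst ℝ ℂ ℂ).comp q₂
  let p₃ := (ContinuousLinearMap.snd ℝ ℂ ℂ).comp q₂
  let A : ℝ → ℂ × ℂ × ℂ × ℂ →L[ℝ] ℂ × ℂ × ℂ × ℂ := fun y =>
    p₁.prod (p₂.prod (p₃.prod (α y • p₂ + β y • p₀)))
  have hA : Continuous A := by
    -- Only the last component depends on `y`. Splitting it off writes `A` as a constant plus a
    -- composition that is visibly continuous in operator norm.
    have hin : ∀ y, A y = p₁.prod (p₂.prod (p₃.prod 0))
        + ((ContinuousLinearMap.inr ℝ ℂ (ℂ × ℂ × ℂ)).comp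
          ((ContinuousLinearMap.inr ℝ ℂ (ℂ × ℂ)).comp (ContinuousLinearMap.inr ℝ ℂ ℂ))).comp
            (α y • p₂ + β y • p₀) := fun y => by
      ext <;> simp [A]
    rw [show A = _ from funext hin]
    exact continuous_const.add (continuous_const.clm_comp
      ((hα.smul continuous_const).add (hβ.smul continuous_const)))
  obtain ⟨Φ, h0, hΦ⟩ := exists_solution_linear_ode hA
    (b := fun y => ((0 : ℂ), (0 : ℂ), (0 : ℂ), f y)) (by fun_prop) ((0 : ℂ), (0 : ℂ), a, b)
  refine ⟨fun y => p₀ (Φ y), fun y => p₁ (Φ y), fun y => p₂ (Φ y), fun y => p₃ (Φ y),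
    ⟨?_, ?_, ?_, ?_⟩, ?_, ?_, ?_, ?_⟩
  · intro y
    refine (p₀.hasFDerivAt.comp_hasDerivAt y (hΦ y)).congr_deriv ?_
    simp [A, p₀]
  · intro y
    refine (p₁.hasFDerivAt.comp_hasDerivAt y (hΦ y)).congr_deriv ?_
    simp [A, p₁, q₁]
  · intro y
    refine (p₂.hasFDerivAt.comp_hasDerivAt y (hΦ y)).congr_deriv ?_
    simp [A, p₂, q₂, q₁]
  · intro y
    refine (p₃.hasFDerivAt.comp_hasDerivAt y (hΦ y)).congr_deriv ?_
    simp [A, p₃, q₂, q₁]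
  all_goals simp [h0, p₀, p₁, p₂, p₃, q₁, q₂]

end IsFourthOrderSolution

/-- One-sided derivatives at the endpoints are still unique. Thus identities that hold only on the
strip can be differentiated up to the walls. -/
theorem deriv_eq_of_eqOn_Icc {f g : ℝ → ℂ} {f' g' : ℂ} {y : ℝ} (hy : y ∈ Set.Icc (0 : ℝ) 1)
    (h : Set.EqOn f g (Set.Icc 0 1)) (hf : HasDerivAt f f' y) (hg : HasDerivAt g g' y) :
    f' = g' :=
  (uniqueDiffOn_Icc zero_lt_one y hy).eq_deriv _ hf.hasDerivWithinAt
    (hg.hasDerivWithinAt.congr h (h hy))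

/-- If the homogeneous boundary value problem has only the trivial solution, then the inhomogeneous
one is solvable, and the equation holds on the whole line. -/
theorem exists_stream_solution {R κ : ℝ} (hR : 0 < R) {s : ℂ}
    (huniq : ∀ ψ, IsStreamSolution R κ s (fun _ => 0) (fun _ => 0) ψ →
      Set.EqOn ψ (fun _ => 0) (Set.Icc 0 1))
    {g : ℝ → ℂ} (hg : ContDiff ℝ ∞ g) :
    ∃ ψ : ℝ → ℂ, ContDiff ℝ ∞ ψ ∧ (∀ y : ℝ,
      (1 / R : ℂ) * iteratedDeriv 4 ψ y
        - (s + 2 * (κ : ℂ) ^ 2 / R + Complex.I * κ * y) * iteratedDeriv 2 ψ y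
        + (s * (κ : ℂ) ^ 2 + (κ : ℂ) ^ 4 / R + Complex.I * (κ : ℂ) ^ 3 * y) * ψ y = g y) ∧
      ψ 0 = 0 ∧ ψ 1 = 0 ∧ deriv ψ 0 = 0 ∧ deriv ψ 1 = 0 := by
  have hR' : (R : ℂ) ≠ 0 := by exact_mod_cast hR.ne'
  have hy : ContDiff ℝ ∞ fun y : ℝ => (y : ℂ) := Complex.ofRealCLM.contDiff
  set α : ℝ → ℂ := fun y => R * (s + 2 * (κ : ℂ) ^ 2 / R + Complex.I * κ * y) with hα
  set β : ℝ → ℂ := fun y =>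
    -R * (s * (κ : ℂ) ^ 2 + (κ : ℂ) ^ 4 / R + Complex.I * (κ : ℂ) ^ 3 * y) with hβ
  have hαs : ContDiff ℝ ∞ α := contDiff_const.mul (contDiff_const.add (contDiff_const.mul hy))
  have hβs : ContDiff ℝ ∞ β := contDiff_const.mul (contDiff_const.add (contDiff_const.mul hy))
  have hode : ∀ {f ψ₀ ψ₁ ψ₂ ψ₃ : ℝ → ℂ}, IsFourthOrderSolution α β f ψ₀ ψ₁ ψ₂ ψ₃ → ∀ y : ℝ,
      (1 / R : ℂ) * iteratedDeriv 4 ψ₀ y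
        - (s + 2 * (κ : ℂ) ^ 2 / R + Complex.I * κ * y) * iteratedDeriv 2 ψ₀ y
        + (s * (κ : ℂ) ^ 2 + (κ : ℂ) ^ 4 / R + Complex.I * (κ : ℂ) ^ 3 * y) * ψ₀ y
        = (1 / R : ℂ) * f y := by
    intro f ψ₀ ψ₁ ψ₂ ψ₃ h y
    rw [h.iteratedDeriv_four, h.iteratedDeriv_two, hα, hβ]
    simp only
    field_simp
    ring
  obtain ⟨a₀, a₁, a₂, a₃, ha, ha0, ha1, ha2, ha3⟩ :=
    IsFourthOrderSolution.exists_of_initial_values hαs.continuous hβs.continuous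
      (f := fun _ => 0) continuous_const 1 0
  obtain ⟨b₀, b₁, b₂, b₃, hb, hb0, hb1, hb2, hb3⟩ :=
    IsFourthOrderSolution.exists_of_initial_values hαs.continuous hβs.continuous
      (f := fun _ => 0) continuous_const 0 1
  have hgR : ContDiff ℝ ∞ fun y => (R : ℂ) * g y := contDiff_const.mul hg
  obtain ⟨c₀, c₁, c₂, c₃, hc, hc0, hc1, -, -⟩ :=
    IsFourthOrderSolution.exists_of_initial_values hαs.continuous hβs.continuous hgR.continuous 0 0
  -- Shooting: `a₀` and `b₀` are homogeneous solutions satisfying the conditions at `0`, and `T`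
  -- sends their coefficients to the values of `ψ` and `ψ'` at `1`. In finite dimension, injectivity
  -- (uniqueness) gives surjectivity (solvability), so the end values of the particular solution
  -- `c₀` can be cancelled.
  let T : ℂ × ℂ →ₗ[ℂ] ℂ × ℂ :=
    { toFun := fun q => (q.1 * a₀ 1 + q.2 * b₀ 1, q.1 * a₁ 1 + q.2 * b₁ 1)
      map_add' := fun p q => by ext <;> simp <;> ring
      map_smul' := fun c q => by ext <;> simp <;> ring }
  have hinj : Function.Injective T := by
    rw [injective_iff_map_eq_zero]
    rintro ⟨p, q⟩ hT
    obtain ⟨hT0, hT1⟩ := Prod.mk.inj hT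
    simp only at hT0 hT1
    set w₀ : ℝ → ℂ := fun y => 0 + p * a₀ y + q * b₀ y
    have h0 : IsFourthOrderSolution α β (fun _ => 0) (fun _ => 0) (fun _ => 0) (fun _ => 0)
        (fun _ => 0) :=
      ⟨fun y => hasDerivAt_const y _, fun y => hasDerivAt_const y _, fun y => hasDerivAt_const y _,
        fun y => by simpa using hasDerivAt_const y (0 : ℂ)⟩
    have h := (h0.add_const_mul ha p).add_const_mul hb q
    have hw : Set.EqOn w₀ (fun _ => 0) (Set.Icc 0 1) := by
      refine huniq w₀ ⟨h.contDiff hαs hβs (by simpa using contDiff_const), fun y _ => ?_, ?_, ?_,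
        ?_, ?_⟩
      · rw [hode h]; simp
      · simp [w₀, ha0, hb0]
      · simpa [w₀] using hT0
      · rw [h.deriv_eq]; simp [ha1, hb1]
      · rw [h.deriv_eq]; simpa using hT1
    -- The coefficients are the initial values `p = ψ''(0)` and `q = ψ'''(0)`, reached by
    -- differentiating `ψ = 0` three times.
    have hw1 : Set.EqOn (fun y => 0 + p * a₁ y + q * b₁ y) (fun _ => 0) (Set.Icc 0 1) :=
      fun y hy => deriv_eq_of_eqOn_Icc hy hw (h.hasDerivAt₀ y) (hasDerivAt_const y _)
    have hw2 : Set.EqOn (fun y => 0 + p * a₂ y + q * b₂ y) (fun _ => 0) (Set.Icc 0 1) :=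
      fun y hy => deriv_eq_of_eqOn_Icc hy hw1 (h.hasDerivAt₁ y) (hasDerivAt_const y _)
    have hw3 : Set.EqOn (fun y => 0 + p * a₃ y + q * b₃ y) (fun _ => 0) (Set.Icc 0 1) :=
      fun y hy => deriv_eq_of_eqOn_Icc hy hw2 (h.hasDerivAt₂ y) (hasDerivAt_const y _)
    have hm : (0 : ℝ) ∈ Set.Icc (0 : ℝ) 1 := by simp
    have e2 := hw2 hm
    have e3 := hw3 hm
    simp only [ha2, hb2, ha3, hb3] at e2 e3
    ext <;> simp_all
  obtain ⟨⟨p, q⟩, hpq⟩ := LinearMap.injective_iff_surjective.mp hinj (-c₀ 1, -c₁ 1)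
  obtain ⟨hpq0, hpq1⟩ := Prod.mk.inj hpq
  simp only at hpq0 hpq1
  have h := (hc.add_const_mul ha p).add_const_mul hb q
  refine ⟨_, h.contDiff hαs hβs (by simpa using hgR), fun y => ?_, ?_, ?_, ?_, ?_⟩
  · rw [hode h]; field_simp; ring
  · simp [hc0, ha0, hb0]
  · linear_combination hpq0
  · rw [h.deriv_eq]; simp [hc1, ha1, hb1]
  · rw [h.deriv_eq]; linear_combination hpq1

/-! ### Norms of represented fields -/

section Represents

variable {ℓ : ℝ} {h h' : L2 ℓ} {u v u' v' : ℝ × ℝ → ℂ}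

theorem Represents.add (H : Represents ℓ h u v) (H' : Represents ℓ h' u' v') :
    Represents ℓ (h + h') (fun z => u z + u' z) (fun z => v z + v' z) := by
  filter_upwards [Lp.coeFn_add h h', H, H'] with z h1 h2 h3
  rw [h1, Pi.add_apply, h2, h3]
  ext i
  fin_cases i <;> simp

theorem Represents.const_smul (c : ℂ) (H : Represents ℓ h u v) :
    Represents ℓ (c • h) (fun z => c * u z) (fun z => c * v z) := by
  filter_upwards [Lp.coeFn_smul c h, H] with z h1 h2
  rw [h1, Pi.smul_apply, h2]
  ext i
  fin_cases i <;> simp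

theorem Represents.sub (H : Represents ℓ h u v) (H' : Represents ℓ h' u' v') :
    Represents ℓ (h - h') (fun z => u z - u' z) (fun z => v z - v' z) := by
  filter_upwards [Lp.coeFn_sub h h', H, H'] with z h1 h2 h3
  rw [h1, Pi.sub_apply, h2, h3]
  ext i
  fin_cases i <;> simp

theorem Represents.congr (H : Represents ℓ h u v)
    (hu : ∀ x, ∀ y ∈ Set.Icc (0 : ℝ) 1, u (x, y) = u' (x, y))
    (hv : ∀ x, ∀ y ∈ Set.Icc (0 : ℝ) 1, v (x, y) = v' (x, y)) : Represents ℓ h u' v' := by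
  have hmem : ∀ᵐ z ∂cell ℓ, z ∈ Set.Icc 0 ℓ ×ˢ Set.Icc (0 : ℝ) 1 :=
    ae_restrict_mem (measurableSet_Icc.prod measurableSet_Icc)
  filter_upwards [H, hmem] with z h1 h2
  rw [h1, hu z.1 z.2 h2.2, hv z.1 z.2 h2.2]

theorem exists_represents (hu : Continuous u) (hv : Continuous v) : ∃ h, Represents ℓ h u v := by
  have hc : Continuous fun z => !₂[u z, v z] := by fun_prop
  have hmem : MemLp (fun z => !₂[u z, v z]) 2 (cell ℓ) := by
    rw [memLp_two_iff_integrable_sq_norm hc.aestronglyMeasurable]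
    exact integrable_cell (by fun_prop)
  exact ⟨hmem.toLp _, hmem.coeFn_toLp⟩

theorem Represents.norm_sq (H : Represents ℓ h u v) (hu : Continuous u) (hv : Continuous v) :
    ‖h‖ ^ 2 = ∫ z, ‖u z‖ ^ 2 ∂cell ℓ + ∫ z, ‖v z‖ ^ 2 ∂cell ℓ := by
  have h1 : ‖h‖ ^ 2 = ∫ z, ‖h z‖ ^ 2 ∂cell ℓ := by
    have := congr_arg RCLike.re (L2.inner_def (𝕜 := ℂ) h h)
    rw [← integral_re (L2.integrable_inner h h)] at this
    simpa only [← norm_sq_eq_re_inner] using this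
  rw [h1, ← integral_add (integrable_cell (by fun_prop)) (integrable_cell (by fun_prop))]
  refine integral_congr_ae ?_
  filter_upwards [H] with z hz
  rw [hz, EuclideanSpace.norm_sq_eq]
  simp

/-- Parseval's identity for vector fields. -/
theorem Represents.hasSum (hℓ : 0 < ℓ) (H : Represents ℓ h u v) (hu : Continuous u)
    (hv : Continuous v) :
    HasSum (fun k => ℓ * (normSq (modeCoeff ℓ k u) + normSq (modeCoeff ℓ k v))) (‖h‖ ^ 2) := by
  rw [H.norm_sq hu hv]
  simpa only [mul_add] using (hasSum_normSq_modeCoeff hℓ hu).add (hasSum_normSq_modeCoeff hℓ hv)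

end Represents

/-! ### Fourier modes of classical solutions -/

theorem IsSmoothSolenoidal.isSolenoidalMode {ℓ : ℝ} (hℓ : 0 < ℓ) {u v : ℝ × ℝ → ℂ}
    (h : IsSmoothSolenoidal ℓ u v) (k : ℤ) :
    IsSolenoidalMode (wavenumber ℓ k) (modeCoeff ℓ k u) (modeCoeff ℓ k v) where
  smooth_F := contDiff_modeCoeff h.smooth_u
  smooth_G := contDiff_modeCoeff h.smooth_v
  div_free y hy := by
    rw [deriv_modeCoeff h.smooth_v, ← modeCoeff_dx hℓ h.smooth_u h.periodic_u,
      ← modeCoeff_add (contDiff_dx h.smooth_u).continuous (contDiff_dy h.smooth_v).continuous]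
    exact modeCoeff_eq_zero fun x => h.div_free x y hy
  wall_zero := modeCoeff_eq_zero h.wall_zero
  wall_one := modeCoeff_eq_zero h.wall_one
  flux_zero := integral_modeCoeff_eq_zero h.smooth_u.continuous h.flux_zero

/-- On the strip, `-∫₀ʸ F` is a stream function of the solenoidal mode `(F, G)`. -/
theorem IsSolenoidalMode.eq_stream {κ : ℝ} {F G : ℝ → ℂ} (h : IsSolenoidalMode κ F G) {y : ℝ}
    (hy : y ∈ Set.Icc (0 : ℝ) 1) :
    G y = Complex.I * κ * -∫ t in (0 : ℝ)..y, F t := by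
  have h1 := intervalIntegral.integral_eq_sub_of_hasDerivAt (f := G) (a := 0) (b := y)
    (fun t _ => (h.smooth_G.differentiable (by simp) t).hasDerivAt)
    ((h.smooth_G.continuous_deriv (by simp)).intervalIntegrable _ _)
  have h2 : ∫ t in (0 : ℝ)..y, deriv G t = ∫ t in (0 : ℝ)..y, -(Complex.I * κ) * F t := by
    refine intervalIntegral.integral_congr fun t ht => ?_
    rw [Set.uIcc_of_le hy.1] at ht
    have := h.div_free t ⟨ht.1, ht.2.trans hy.2⟩
    linear_combination this
  rw [h2, intervalIntegral.integral_const_mul, h.wall_zero] at h1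
  linear_combination -h1

section Smoothness

variable {R : ℝ} {u v p : ℝ × ℝ → ℂ}

theorem contDiff_ofReal_snd : ContDiff ℝ ∞ fun z : ℝ × ℝ => (z.2 : ℂ) :=
  Complex.ofRealCLM.contDiff.comp contDiff_snd

theorem contDiff_lap (hu : ContDiff ℝ ∞ u) : ContDiff ℝ ∞ (lap u) :=
  (contDiff_dx (contDiff_dx hu)).add (contDiff_dy (contDiff_dy hu))

theorem contDiff_advU (hu : ContDiff ℝ ∞ u) (hv : ContDiff ℝ ∞ v) : ContDiff ℝ ∞ (advU u v) :=
  hv.add (contDiff_ofReal_snd.mul (contDiff_dx hu))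

theorem contDiff_advV (hv : ContDiff ℝ ∞ v) : ContDiff ℝ ∞ (advV v) :=
  contDiff_ofReal_snd.mul (contDiff_dx hv)

theorem contDiff_rhsU (hu : ContDiff ℝ ∞ u) (hv : ContDiff ℝ ∞ v) (hp : ContDiff ℝ ∞ p) :
    ContDiff ℝ ∞ (rhsU R u v p) :=
  ((contDiff_const.mul (contDiff_lap hu)).sub (contDiff_advU hu hv)).sub (contDiff_dx hp)

theorem contDiff_rhsV (hv : ContDiff ℝ ∞ v) (hp : ContDiff ℝ ∞ p) :
    ContDiff ℝ ∞ (rhsV R v p) :=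
  ((contDiff_const.mul (contDiff_lap hv)).sub (contDiff_advV hv)).sub (contDiff_dy hp)

end Smoothness

/-! ### Fourier coefficients of the linearized Navier–Stokes operator. -/

section ModeEquations

variable {ℓ R : ℝ} {k : ℤ} {u v p : ℝ × ℝ → ℂ}

theorem modeCoeff_const_mul (c : ℂ) (f : ℝ × ℝ → ℂ) (y : ℝ) :
    modeCoeff ℓ k (fun z => c * f z) y = c * modeCoeff ℓ k f y :=
  modeCoeff_mul_left (fun _ => c) f y

theorem modeCoeff_lap (hℓ : 0 < ℓ) (hu : ContDiff ℝ ∞ u)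
    (hper : ∀ x y, u (x + ℓ, y) = u (x, y)) (y : ℝ) :
    modeCoeff ℓ k (lap u) y = -(wavenumber ℓ k : ℂ) ^ 2 * modeCoeff ℓ k u y
      + deriv (deriv (modeCoeff ℓ k u)) y := by
  have hper' : ∀ x y, u (x + ℓ, y) = u (x, y) + 0 := by simpa using hper
  have h1 : modeCoeff ℓ k (lap u) y = _ :=
    modeCoeff_add (contDiff_dx (contDiff_dx hu)).continuous
      (contDiff_dy (contDiff_dy hu)).continuous y
  rw [h1, modeCoeff_dx hℓ (contDiff_dx hu) (dx_periodic hu hper'), modeCoeff_dx hℓ hu hper,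
    deriv_modeCoeff hu, deriv_modeCoeff (contDiff_dy hu)]
  linear_combination (wavenumber ℓ k : ℂ) ^ 2 * modeCoeff ℓ k u y * Complex.I_sq

theorem modeCoeff_advV (hℓ : 0 < ℓ) (hv : ContDiff ℝ ∞ v)
    (hper : ∀ x y, v (x + ℓ, y) = v (x, y)) (y : ℝ) :
    modeCoeff ℓ k (advV v) y = y * (Complex.I * wavenumber ℓ k * modeCoeff ℓ k v y) := by
  have h1 : modeCoeff ℓ k (advV v) y = _ := modeCoeff_mul_left (fun y : ℝ => (y : ℂ)) (dx v) y
  rw [h1, modeCoeff_dx hℓ hv hper]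

theorem modeCoeff_advU (hℓ : 0 < ℓ) (hu : ContDiff ℝ ∞ u) (hv : ContDiff ℝ ∞ v)
    (hper : ∀ x y, u (x + ℓ, y) = u (x, y)) (y : ℝ) :
    modeCoeff ℓ k (advU u v) y
      = modeCoeff ℓ k v y + y * (Complex.I * wavenumber ℓ k * modeCoeff ℓ k u y) := by
  have h1 : modeCoeff ℓ k (advU u v) y = _ :=
    modeCoeff_add hv.continuous (contDiff_advV hu).continuous y
  rw [h1, modeCoeff_advV hℓ hu hper]

theorem modeCoeff_rhsU (hℓ : 0 < ℓ) (hu : ContDiff ℝ ∞ u) (hv : ContDiff ℝ ∞ v)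
    (hp : ContDiff ℝ ∞ p) (hper : ∀ x y, u (x + ℓ, y) = u (x, y)) (y : ℝ) :
    modeCoeff ℓ k (rhsU R u v p) y
      = (1 / R : ℂ) * (-(wavenumber ℓ k : ℂ) ^ 2 * modeCoeff ℓ k u y
          + deriv (deriv (modeCoeff ℓ k u)) y)
        - (modeCoeff ℓ k v y + y * (Complex.I * wavenumber ℓ k * modeCoeff ℓ k u y))
        - modeCoeff ℓ k (dx p) y := by
  have hl := (contDiff_const (c := (1 / R : ℂ))).mul (contDiff_lap hu)
  have h1 : modeCoeff ℓ k (rhsU R u v p) y = _ :=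
    modeCoeff_sub (hl.sub (contDiff_advU hu hv)).continuous (contDiff_dx hp).continuous y
  rw [h1, modeCoeff_sub hl.continuous (contDiff_advU hu hv).continuous, modeCoeff_const_mul,
    modeCoeff_lap hℓ hu hper, modeCoeff_advU hℓ hu hv hper]

theorem modeCoeff_rhsV (hℓ : 0 < ℓ) (hv : ContDiff ℝ ∞ v)
    (hp : ContDiff ℝ ∞ p) (hper : ∀ x y, v (x + ℓ, y) = v (x, y)) (y : ℝ) :
    modeCoeff ℓ k (rhsV R v p) y
      = (1 / R : ℂ) * (-(wavenumber ℓ k : ℂ) ^ 2 * modeCoeff ℓ k v y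
          + deriv (deriv (modeCoeff ℓ k v)) y)
        - y * (Complex.I * wavenumber ℓ k * modeCoeff ℓ k v y)
        - modeCoeff ℓ k (dy p) y := by
  have hl := (contDiff_const (c := (1 / R : ℂ))).mul (contDiff_lap hv)
  have h1 : modeCoeff ℓ k (rhsV R v p) y = _ :=
    modeCoeff_sub (hl.sub (contDiff_advV hv)).continuous (contDiff_dy hp).continuous y
  rw [h1, modeCoeff_sub hl.continuous (contDiff_advV hv).continuous, modeCoeff_const_mul,
    modeCoeff_lap hℓ hv hper, modeCoeff_advV hℓ hv hper]

end ModeEquations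

theorem hasDerivAt_of_contDiff {f : ℝ → ℂ} (hf : ContDiff ℝ ∞ f) (y : ℝ) :
    HasDerivAt f (deriv f y) y :=
  (hf.differentiable (by simp) y).hasDerivAt

theorem contDiff_deriv {f : ℝ → ℂ} (hf : ContDiff ℝ ∞ f) : ContDiff ℝ ∞ (deriv f) :=
  (contDiff_infty_iff_deriv.mp hf).2

theorem hasDerivAt_ofReal (y : ℝ) : HasDerivAt (fun y : ℝ => (y : ℂ)) 1 y :=
  Complex.ofRealCLM.hasDerivAt

/-- The modes of `s w - L w` for a classical `w` are solenoidal, and the stream function of the mode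
of `w` solves the boundary value problem with this forcing. -/
theorem exists_stream_of_classical {ℓ R : ℝ} (hℓ : 0 < ℓ) (s : ℂ) {u v p : ℝ × ℝ → ℂ}
    (hw : IsSmoothSolenoidal ℓ u v) (hu0 : ∀ x : ℝ, u (x, 0) = 0) (hu1 : ∀ x : ℝ, u (x, 1) = 0)
    (hp : IsPressure ℓ R u v p) (k : ℤ) :
    ∃ ψ : ℝ → ℂ,
      IsSolenoidalMode (wavenumber ℓ k) (modeCoeff ℓ k fun z => s * u z - rhsU R u v p z)
        (modeCoeff ℓ k fun z => s * v z - rhsV R v p z) ∧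
      IsStreamSolution R (wavenumber ℓ k) s (modeCoeff ℓ k fun z => s * u z - rhsU R u v p z)
        (modeCoeff ℓ k fun z => s * v z - rhsV R v p z) ψ ∧
      (∀ y, deriv ψ y = -modeCoeff ℓ k u y) ∧
      ∀ y ∈ Set.Icc (0 : ℝ) 1, modeCoeff ℓ k v y = Complex.I * wavenumber ℓ k * ψ y := by
  obtain ⟨c, hc⟩ := hp.periodic_grad
  have hus := hw.smooth_u
  have hvs := hw.smooth_v
  have hps := hp.smooth
  have hru : ContDiff ℝ ∞ (rhsU R u v p) := contDiff_rhsU hus hvs hps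
  have hrv : ContDiff ℝ ∞ (rhsV R v p) := contDiff_rhsV hvs hps
  have hsu : ContDiff ℝ ∞ fun z => s * u z := contDiff_const.mul hus
  have hsv : ContDiff ℝ ∞ fun z => s * v z := contDiff_const.mul hvs
  have hmode := hw.isSolenoidalMode hℓ k
  set κ := wavenumber ℓ k with hκ
  set U := modeCoeff ℓ k u with hU
  set V := modeCoeff ℓ k v with hV
  set F := modeCoeff ℓ k fun z => s * u z - rhsU R u v p z with hF
  set G := modeCoeff ℓ k fun z => s * v z - rhsV R v p z with hG
  set Px := modeCoeff ℓ k (dx p) with hPx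
  set Py := modeCoeff ℓ k (dy p) with hPy
  have hUs : ContDiff ℝ ∞ U := contDiff_modeCoeff hus
  have hVs : ContDiff ℝ ∞ V := contDiff_modeCoeff hvs
  have hPxs : ContDiff ℝ ∞ Px := contDiff_modeCoeff (contDiff_dx hps)
  have hPys : ContDiff ℝ ∞ Py := contDiff_modeCoeff (contDiff_dy hps)
  have hU1 := contDiff_deriv hUs
  have hV1 := contDiff_deriv hVs
  have hU2 := contDiff_deriv hU1
  have hV2 := contDiff_deriv hV1
  have hFy : ∀ y : ℝ, F y = s * U y - ((1 / R : ℂ) * (-(κ : ℂ) ^ 2 * U y + deriv (deriv U) y)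
      - (V y + y * (Complex.I * κ * U y)) - Px y) := fun y => by
    rw [hF, modeCoeff_sub hsu.continuous hru.continuous, modeCoeff_const_mul,
      modeCoeff_rhsU hℓ hus hvs hps hw.periodic_u]
  have hGy : ∀ y : ℝ, G y = s * V y - ((1 / R : ℂ) * (-(κ : ℂ) ^ 2 * V y + deriv (deriv V) y)
      - y * (Complex.I * κ * V y) - Py y) := fun y => by
    rw [hG, modeCoeff_sub hsv.continuous hrv.continuous, modeCoeff_const_mul,
      modeCoeff_rhsV hℓ hvs hps hw.periodic_v]
  have hF' : ∀ y : ℝ, deriv F y = s * deriv U y - ((1 / R : ℂ) * (-(κ : ℂ) ^ 2 * deriv U y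
      + deriv (deriv (deriv U)) y)
      - (deriv V y + (Complex.I * κ * U y + y * (Complex.I * κ * deriv U y))) - deriv Px y) := by
    intro y
    rw [show F = _ from funext hFy]
    have dU := hasDerivAt_of_contDiff hUs y
    refine (((dU.const_mul s).sub ((((dU.const_mul _).add
      (hasDerivAt_of_contDiff hU2 y)).const_mul _).sub ((hasDerivAt_of_contDiff hVs y).add
      ((hasDerivAt_ofReal y).mul (dU.const_mul _)))|>.sub
      (hasDerivAt_of_contDiff hPxs y)))).deriv.trans ?_
    ring
  have hG' : ∀ y : ℝ, deriv G y = s * deriv V y - ((1 / R : ℂ) * (-(κ : ℂ) ^ 2 * deriv V y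
      + deriv (deriv (deriv V)) y)
      - (Complex.I * κ * V y + y * (Complex.I * κ * deriv V y)) - deriv Py y) := by
    intro y
    rw [show G = _ from funext hGy]
    have dV := hasDerivAt_of_contDiff hVs y
    refine (((dV.const_mul s).sub ((((dV.const_mul _).add
      (hasDerivAt_of_contDiff hV2 y)).const_mul _).sub
      ((hasDerivAt_ofReal y).mul (dV.const_mul _))|>.sub
      (hasDerivAt_of_contDiff hPys y)))).deriv.trans ?_
    ring
  -- The gradient of `p` is curl free, which removes the pressure from `F' - iκG`. Fourier's rule
  -- for `dx` is applied to `dy p`, since `p` itself need not be periodic.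
  have hcurl : ∀ y, deriv Px y = Complex.I * κ * Py y := fun y => by
    rw [hPx, deriv_modeCoeff (contDiff_dx hps), ← dx_dy_comm hps,
      modeCoeff_dx hℓ (contDiff_dy hps) (dy_periodic hps hc)]
  have hpoisson : ∀ y ∈ Set.Icc (0 : ℝ) 1, Complex.I * κ * Px y + deriv Py y
      = -(Complex.I * κ * (V y + y * (Complex.I * κ * U y))
        + (Complex.I * κ * V y + y * (Complex.I * κ * deriv V y))) := by
    intro y hy
    have hadvU := contDiff_advU hus hvs
    have hadvV := contDiff_advV hvs
    have hper : ∀ x y, advU u v (x + ℓ, y) = advU u v (x, y) := fun x y => by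
      simp only [advU, hw.periodic_v,
        dx_periodic hus (c := 0) (by simpa using hw.periodic_u)]
    have h1 : modeCoeff ℓ k (lap p) y
        = -1 * modeCoeff ℓ k (fun z => dx (advU u v) z + dy (advV v) z) y := by
      rw [← modeCoeff_const_mul]
      refine modeCoeff_congr fun x => ?_
      rw [hp.poisson x y hy]
      ring
    have h2 : modeCoeff ℓ k (lap p) y = _ := modeCoeff_add
      (contDiff_dx (contDiff_dx hps)).continuous (contDiff_dy (contDiff_dy hps)).continuous y
    have h3 : deriv (modeCoeff ℓ k (advV v)) y
        = Complex.I * κ * V y + y * (Complex.I * κ * deriv V y) := by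
      rw [show modeCoeff ℓ k (advV v) = _ from
        funext fun y => modeCoeff_advV hℓ hvs hw.periodic_v y]
      refine ((hasDerivAt_ofReal y).mul
        ((hasDerivAt_of_contDiff hVs y).const_mul _)).deriv.trans ?_
      ring
    rw [modeCoeff_add (contDiff_dx hadvU).continuous (contDiff_dy hadvV).continuous,
      modeCoeff_dx hℓ hadvU hper, modeCoeff_advU hℓ hus hvs hw.periodic_u,
      ← deriv_modeCoeff hadvV, h3, h2, modeCoeff_dx hℓ (contDiff_dx hps) (dx_periodic hps hc),
      ← deriv_modeCoeff (contDiff_dy hps)] at h1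
    linear_combination h1
  have hdiv : Set.EqOn (deriv V) (fun y => -(Complex.I * κ) * U y) (Set.Icc 0 1) := fun y hy => by
    linear_combination hmode.div_free y hy
  have hdiv1 : Set.EqOn (deriv (deriv V)) (fun y => -(Complex.I * κ) * deriv U y)
      (Set.Icc 0 1) := fun y hy =>
    deriv_eq_of_eqOn_Icc hy hdiv (hasDerivAt_of_contDiff hV1 y)
      ((hasDerivAt_of_contDiff hUs y).const_mul _)
  have hdiv2 : Set.EqOn (deriv (deriv (deriv V))) (fun y => -(Complex.I * κ) * deriv (deriv U) y)
      (Set.Icc 0 1) := fun y hy =>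
    deriv_eq_of_eqOn_Icc hy hdiv1 (hasDerivAt_of_contDiff hV2 y)
      ((hasDerivAt_of_contDiff hU1 y).const_mul _)
  have hV0 : V 0 = 0 := hmode.wall_zero
  have hV1' : V 1 = 0 := hmode.wall_one
  have hwall : ∀ y : ℝ, (∀ x, dy p (x, y) = (1 / R : ℂ) * dy (dy v) (x, y)) →
      Py y = (1 / R : ℂ) * deriv (deriv V) y := fun y h => by
    rw [hV, deriv_modeCoeff hvs, deriv_modeCoeff (contDiff_dy hvs), ← modeCoeff_const_mul]
    exact modeCoeff_congr h
  -- The stream function starts from zero at the lower wall; it vanishes at the upper wall because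
  -- `U` has no flux.
  set ψ : ℝ → ℂ := fun y => -∫ t in (0 : ℝ)..y, U t with hψ
  have hψ' : ∀ y, HasDerivAt ψ (-U y) y := fun y =>
    (hUs.continuous.integral_hasStrictDerivAt 0 y).hasDerivAt.neg
  have hψd : deriv ψ = fun y => -U y := funext fun y => (hψ' y).deriv
  have hψd2 : deriv (deriv ψ) = fun y => -deriv U y := by
    rw [hψd]; exact funext fun y => (hasDerivAt_of_contDiff hUs y).neg.deriv
  have hψd3 : deriv (deriv (deriv ψ)) = fun y => -deriv (deriv U) y := by
    rw [hψd2]; exact funext fun y => (hasDerivAt_of_contDiff hU1 y).neg.deriv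
  have hψd4 : deriv (deriv (deriv (deriv ψ))) = fun y => -deriv (deriv (deriv U)) y := by
    rw [hψd3]; exact funext fun y => (hasDerivAt_of_contDiff hU2 y).neg.deriv
  have hVψ : ∀ y ∈ Set.Icc (0 : ℝ) 1, V y = Complex.I * κ * ψ y := fun y hy =>
    hmode.eq_stream hy
  refine ⟨ψ, ⟨contDiff_modeCoeff (hsu.sub hru), contDiff_modeCoeff (hsv.sub hrv), ?_, ?_, ?_, ?_⟩,
    ⟨?_, ?_, ?_, ?_, ?_, ?_⟩, fun y => (hψ' y).deriv, hVψ⟩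
  -- The Laplacian of a divergence free field is divergence free, and the Poisson equation cancels
  -- the divergence of the advection terms.
  · intro y hy
    have e2 := hdiv2 hy
    have e0 := hdiv hy
    have e3 := hpoisson y hy
    simp only at e0 e2
    rw [hFy, hG', e2, e0]
    rw [e0] at e3
    linear_combination e3
  -- At a wall `V = 0`, and the Neumann condition cancels the remaining `V'' / R`.
  · rw [hGy, hwall 0 hp.wall_zero, hV0]
    push_cast
    ring
  · rw [hGy, hwall 1 hp.wall_one, hV1']
    push_cast
    ring
  · refine integral_modeCoeff_eq_zero (hsu.sub hru).continuous fun x => ?_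
    rw [intervalIntegral.integral_sub, intervalIntegral.integral_const_mul, hw.flux_zero,
      hp.flux_zero, mul_zero, sub_zero]
    · exact Continuous.intervalIntegrable (hsu.continuous.comp (by fun_prop)) _ _
    · exact Continuous.intervalIntegrable (hru.continuous.comp (by fun_prop)) _ _
  · rw [contDiff_infty_iff_deriv, hψd]
    exact ⟨fun y => (hψ' y).differentiableAt, hUs.neg⟩
  · intro y hy
    have e0 := hdiv hy
    have e1 := hdiv1 hy
    simp only at e0 e1
    have hi2 : iteratedDeriv 2 ψ y = -deriv U y := by
      simp only [iteratedDeriv_succ, iteratedDeriv_zero]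
      rw [hψd2]
    have hi4 : iteratedDeriv 4 ψ y = -deriv (deriv (deriv U)) y := by
      simp only [iteratedDeriv_succ, iteratedDeriv_zero]
      rw [hψd4]
    rw [hF', hGy, hcurl, e0, e1, hVψ y hy, hi2, hi4]
    -- After substitution the two sides differ only by uses of `I ^ 2 = -1`.
    linear_combination ((κ : ℂ) ^ 2 * s * ψ y + (κ : ℂ) ^ 2 / R * deriv U y
      + (κ : ℂ) ^ 4 / R * ψ y + Complex.I * κ ^ 3 * y * ψ y) * Complex.I_sq
  · simp [hψ]
  · simpa [hψ] using hmode.flux_zero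
  · rw [hψd]
    simpa using modeCoeff_eq_zero hu0
  · rw [hψd]
    simpa using modeCoeff_eq_zero hu1

/-! ### The resolvent estimate on classical solutions -/

/-- The a priori estimates for the boundary value problem of all modes. -/
def StreamEstimate (ℓ R C : ℝ) (s : ℂ) : Prop :=
  ∀ (k : ℤ) (F G ψ : ℝ → ℂ), IsSolenoidalMode (wavenumber ℓ k) F G →
    IsStreamSolution R (wavenumber ℓ k) s F G ψ →
    wavenumber ℓ k ^ 2 * normSq ψ ≤ C * R ^ 2 * (normSq F + normSq G) ∧
      normSq (deriv ψ) ≤ C * R ^ 2 * (normSq F + normSq G)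

/-- The bound on `ψ'` is the one to use, because the bound on `κψ` says nothing at `κ = 0`. It
forces `ψ' = 0`, and `ψ 0 = 0` does the rest. -/
theorem StreamEstimate.eqOn_zero {ℓ R C : ℝ} {s : ℂ} (hE : StreamEstimate ℓ R C s) (k : ℤ)
    {ψ : ℝ → ℂ} (hψ : IsStreamSolution R (wavenumber ℓ k) s (fun _ => 0) (fun _ => 0) ψ) :
    Set.EqOn ψ (fun _ => 0) (Set.Icc 0 1) := by
  have hmode : IsSolenoidalMode (wavenumber ℓ k) (fun _ => 0) (fun _ => 0) :=
    ⟨contDiff_const, contDiff_const, by simp, rfl, rfl, by simp⟩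
  have h := (hE k _ _ ψ hmode hψ).2
  have hc : Continuous (deriv ψ) := hψ.smooth.continuous_deriv (by simp)
  have hd : ∀ y ∈ Set.Icc (0 : ℝ) 1, deriv ψ y = 0 := by
    intro y hy
    by_contra hne
    have : 0 < normSq (deriv ψ) :=
      intervalIntegral.integral_pos zero_lt_one
        (hc.norm.pow 2).continuousOn (fun _ _ => by positivity)
        ⟨y, hy, by positivity⟩
    simp [normSq] at h this
    linarith
  intro y hy
  have h1 := intervalIntegral.integral_eq_sub_of_hasDerivAt (f := ψ) (a := 0) (b := y)
    (fun t _ => hasDerivAt_of_contDiff hψ.smooth t) (hc.intervalIntegrable _ _)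
  have h2 : ∫ t in (0 : ℝ)..y, deriv ψ t = ∫ t in (0 : ℝ)..y, (0 : ℂ) := by
    refine intervalIntegral.integral_congr fun t ht => ?_
    rw [Set.uIcc_of_le hy.1] at ht
    exact hd t ⟨ht.1, ht.2.trans hy.2⟩
  rw [h2, hψ.zero_zero, sub_zero, intervalIntegral.integral_zero] at h1
  exact h1.symm

/-- The two components of a mode of `w` have squared norms `‖ψ'‖²` and `κ²‖ψ‖²`. Each has its own
bound, whence the factor `2`; Parseval's identity on both sides adds up the modes. -/
theorem StreamEstimate.norm_sq_le {ℓ R C : ℝ} (hℓ : 0 < ℓ) {s : ℂ}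
    (hE : StreamEstimate ℓ R C s) {q : solenoidal ℓ × solenoidal ℓ} (hq : q ∈ classicalGraph ℓ R) :
    ‖q.1‖ ^ 2 ≤ 2 * C * R ^ 2 * ‖s • q.1 - q.2‖ ^ 2 := by
  obtain ⟨u, v, p, hw, hu0, hu1, hp, hq1, hq2⟩ := hq
  have hf := contDiff_const (c := s).mul hw.smooth_u |>.sub
    (contDiff_rhsU (R := R) hw.smooth_u hw.smooth_v hp.smooth)
  have hg := contDiff_const (c := s).mul hw.smooth_v |>.sub
    (contDiff_rhsV (R := R) hw.smooth_v hp.smooth)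
  have hS1 := hq1.hasSum hℓ hw.smooth_u.continuous hw.smooth_v.continuous
  have hS2 := ((hq1.const_smul s).sub hq2).hasSum hℓ hf.continuous hg.continuous
  refine hasSum_le (fun k => ?_) hS1 (hS2.mul_left (2 * C * R ^ 2))
  obtain ⟨ψ, hmode, hψ, hψ', hVψ⟩ := exists_stream_of_classical hℓ s hw hu0 hu1 hp k
  obtain ⟨h1, h2⟩ := hE k _ _ ψ hmode hψ
  have e1 : normSq (modeCoeff ℓ k u) = normSq (deriv ψ) := by
    simp only [normSq, hψ', norm_neg]
  have e2 : normSq (modeCoeff ℓ k v) = wavenumber ℓ k ^ 2 * normSq ψ := by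
    rw [normSq, normSq, ← intervalIntegral.integral_const_mul]
    refine intervalIntegral.integral_congr fun y hy => ?_
    rw [Set.uIcc_of_le zero_le_one] at hy
    simp only [hVψ y hy, norm_mul, Complex.norm_I, one_mul, Complex.norm_real, mul_pow,
      Real.norm_eq_abs, sq_abs]
  rw [e1, e2]
  nlinarith

/-! ### Linearity of the classical operator -/

section Linearity

variable {ℓ R : ℝ} {f f' u v p u' v' p' : ℝ × ℝ → ℂ}

theorem dx_add_const_mul (hf : ContDiff ℝ ∞ f) (hf' : ContDiff ℝ ∞ f') (c : ℂ) :
    dx (fun z => f z + c * f' z) = fun z => dx f z + c * dx f' z := by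
  funext ⟨x, y⟩
  exact (hasDerivAt_fst (hf.add (contDiff_const.mul hf')) x y).unique
    ((hasDerivAt_fst hf x y).add ((hasDerivAt_fst hf' x y).const_mul c))

theorem dy_add_const_mul (hf : ContDiff ℝ ∞ f) (hf' : ContDiff ℝ ∞ f') (c : ℂ) :
    dy (fun z => f z + c * f' z) = fun z => dy f z + c * dy f' z := by
  funext ⟨x, y⟩
  exact (hasDerivAt_snd (hf.add (contDiff_const.mul hf')) x y).unique
    ((hasDerivAt_snd hf x y).add ((hasDerivAt_snd hf' x y).const_mul c))

theorem lap_add_const_mul (hf : ContDiff ℝ ∞ f) (hf' : ContDiff ℝ ∞ f') (c : ℂ) :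
    lap (fun z => f z + c * f' z) = fun z => lap f z + c * lap f' z := by
  funext z
  unfold lap
  rw [dx_add_const_mul hf hf', dy_add_const_mul hf hf',
    dx_add_const_mul (contDiff_dx hf) (contDiff_dx hf'),
    dy_add_const_mul (contDiff_dy hf) (contDiff_dy hf')]
  ring

theorem advV_add_const_mul (hv : ContDiff ℝ ∞ v) (hv' : ContDiff ℝ ∞ v') (c : ℂ) :
    advV (fun z => v z + c * v' z) = fun z => advV v z + c * advV v' z := by
  funext z
  unfold advV
  rw [dx_add_const_mul hv hv']
  ring

theorem advU_add_const_mul (hu : ContDiff ℝ ∞ u) (hu' : ContDiff ℝ ∞ u') (c : ℂ) :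
    advU (fun z => u z + c * u' z) (fun z => v z + c * v' z)
      = fun z => advU u v z + c * advU u' v' z := by
  funext z
  unfold advU
  rw [dx_add_const_mul hu hu']
  ring

theorem rhsU_add_const_mul (hu : ContDiff ℝ ∞ u) (hu' : ContDiff ℝ ∞ u') (hp : ContDiff ℝ ∞ p)
    (hp' : ContDiff ℝ ∞ p') (c : ℂ) :
    rhsU R (fun z => u z + c * u' z) (fun z => v z + c * v' z) (fun z => p z + c * p' z)
      = fun z => rhsU R u v p z + c * rhsU R u' v' p' z := by
  funext z
  unfold rhsU
  rw [lap_add_const_mul hu hu', advU_add_const_mul hu hu', dx_add_const_mul hp hp']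
  ring

theorem rhsV_add_const_mul (hv : ContDiff ℝ ∞ v) (hv' : ContDiff ℝ ∞ v') (hp : ContDiff ℝ ∞ p)
    (hp' : ContDiff ℝ ∞ p') (c : ℂ) :
    rhsV R (fun z => v z + c * v' z) (fun z => p z + c * p' z)
      = fun z => rhsV R v p z + c * rhsV R v' p' z := by
  funext z
  unfold rhsV
  rw [lap_add_const_mul hv hv', advV_add_const_mul hv hv', dy_add_const_mul hp hp']
  ring

theorem integral_add_const_mul_eq_zero (hf : Continuous f) (hf' : Continuous f') (c : ℂ) {x : ℝ}
    (h : ∫ y in (0 : ℝ)..1, f (x, y) = 0) (h' : ∫ y in (0 : ℝ)..1, f' (x, y) = 0) :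
    ∫ y in (0 : ℝ)..1, (f (x, y) + c * f' (x, y)) = 0 := by
  rw [intervalIntegral.integral_add, intervalIntegral.integral_const_mul, h, h', mul_zero, add_zero]
  · exact Continuous.intervalIntegrable (by fun_prop) _ _
  · exact Continuous.intervalIntegrable (by fun_prop) _ _

theorem IsSmoothSolenoidal.add_const_mul (h : IsSmoothSolenoidal ℓ u v)
    (h' : IsSmoothSolenoidal ℓ u' v') (c : ℂ) :
    IsSmoothSolenoidal ℓ (fun z => u z + c * u' z) (fun z => v z + c * v' z) where
  smooth_u := h.smooth_u.add (contDiff_const.mul h'.smooth_u)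
  smooth_v := h.smooth_v.add (contDiff_const.mul h'.smooth_v)
  periodic_u x y := by simp only [h.periodic_u, h'.periodic_u]
  periodic_v x y := by simp only [h.periodic_v, h'.periodic_v]
  div_free x y hy := by
    rw [dx_add_const_mul h.smooth_u h'.smooth_u, dy_add_const_mul h.smooth_v h'.smooth_v]
    linear_combination h.div_free x y hy + c * h'.div_free x y hy
  wall_zero x := by simp only [h.wall_zero, h'.wall_zero, mul_zero, add_zero]
  wall_one x := by simp only [h.wall_one, h'.wall_one, mul_zero, add_zero]
  flux_zero x := integral_add_const_mul_eq_zero h.smooth_u.continuous h'.smooth_u.continuous c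
    (h.flux_zero x) (h'.flux_zero x)

theorem IsPressure.add_const_mul (h : IsPressure ℓ R u v p) (h' : IsPressure ℓ R u' v' p')
    (hu : ContDiff ℝ ∞ u) (hu' : ContDiff ℝ ∞ u') (hv : ContDiff ℝ ∞ v) (hv' : ContDiff ℝ ∞ v')
    (c : ℂ) :
    IsPressure ℓ R (fun z => u z + c * u' z) (fun z => v z + c * v' z)
      (fun z => p z + c * p' z) where
  smooth := h.smooth.add (contDiff_const.mul h'.smooth)
  periodic_grad := by
    obtain ⟨a, ha⟩ := h.periodic_grad
    obtain ⟨b, hb⟩ := h'.periodic_grad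
    exact ⟨a + c * b, fun x y => by simp only [ha, hb]; ring⟩
  poisson x y hy := by
    rw [lap_add_const_mul h.smooth h'.smooth, advU_add_const_mul hu hu', advV_add_const_mul hv hv',
      dx_add_const_mul (contDiff_advU hu hv) (contDiff_advU hu' hv'),
      dy_add_const_mul (contDiff_advV hv) (contDiff_advV hv')]
    linear_combination h.poisson x y hy + c * h'.poisson x y hy
  wall_zero x := by
    rw [dy_add_const_mul h.smooth h'.smooth, dy_add_const_mul hv hv',
      dy_add_const_mul (contDiff_dy hv) (contDiff_dy hv')]
    linear_combination h.wall_zero x + c * h'.wall_zero x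
  wall_one x := by
    rw [dy_add_const_mul h.smooth h'.smooth, dy_add_const_mul hv hv',
      dy_add_const_mul (contDiff_dy hv) (contDiff_dy hv')]
    linear_combination h.wall_one x + c * h'.wall_one x
  flux_zero x := by
    rw [rhsU_add_const_mul hu hu' h.smooth h'.smooth]
    exact integral_add_const_mul_eq_zero (contDiff_rhsU hu hv h.smooth).continuous
      (contDiff_rhsU hu' hv' h'.smooth).continuous c (h.flux_zero x) (h'.flux_zero x)

/-- This single law gives both submodule axioms: sums with `c = 1`, multiples with `q = 0`. -/
theorem add_smul_mem_classicalGraph {q q' : solenoidal ℓ × solenoidal ℓ}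
    (hq : q ∈ classicalGraph ℓ R) (hq' : q' ∈ classicalGraph ℓ R) (c : ℂ) :
    q + c • q' ∈ classicalGraph ℓ R := by
  obtain ⟨u, v, p, hw, hu0, hu1, hp, hq1, hq2⟩ := hq
  obtain ⟨u', v', p', hw', hu0', hu1', hp', hq1', hq2'⟩ := hq'
  refine ⟨_, _, _, hw.add_const_mul hw' c, fun x => ?_, fun x => ?_,
    hp.add_const_mul hp' hw.smooth_u hw'.smooth_u hw.smooth_v hw'.smooth_v c,
    hq1.add (hq1'.const_smul c), ?_⟩
  · simp only [hu0, hu0', mul_zero, add_zero]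
  · simp only [hu1, hu1', mul_zero, add_zero]
  · rw [rhsU_add_const_mul hw.smooth_u hw'.smooth_u hp.smooth hp'.smooth,
      rhsV_add_const_mul hw.smooth_v hw'.smooth_v hp.smooth hp'.smooth]
    exact hq2.add (hq2'.const_smul c)

end Linearity

/-- The graph of the classical operator as a submodule. -/
def classicalSubmodule (ℓ R : ℝ) : Submodule ℂ (solenoidal ℓ × solenoidal ℓ) :=
  have h0 : (0 : solenoidal ℓ × solenoidal ℓ) ∈ classicalGraph ℓ R := by
    have hx : dx (fun _ => 0) = fun _ => 0 := by funext z; simp [dx]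
    have hy : dy (fun _ => 0) = fun _ => 0 := by funext z; simp [dy]
    have hl : lap (fun _ => 0) = fun _ => 0 := by funext z; simp [lap, hx, hy]
    have hU : advU (fun _ => 0) (fun _ => 0) = fun _ => 0 := by funext z; simp [advU, hx]
    have hV : advV (fun _ => 0) = fun _ => 0 := by funext z; simp [advV, hx]
    have hrU : rhsU R (fun _ => 0) (fun _ => 0) (fun _ => 0) = fun _ => 0 := by
      funext z; simp [rhsU, hl, hU, hx]
    have hrV : rhsV R (fun _ => 0) (fun _ => 0) = fun _ => 0 := by
      funext z; simp [rhsV, hl, hV, hy]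
    have hrep : Represents ℓ 0 (fun _ => 0) (fun _ => 0) := by
      filter_upwards [Lp.coeFn_zero (EuclideanSpace ℂ (Fin 2)) 2 (cell ℓ)] with z hz
      rw [hz]
      ext i
      fin_cases i <;> simp
    refine ⟨fun _ => 0, fun _ => 0, fun _ => 0, ?_, by simp, by simp, ?_, hrep, ?_⟩
    · constructor <;> simp [contDiff_const, hx, hy]
    · constructor <;> simp [contDiff_const, hl, hU, hV, hx, hy, hrU]
    · rw [hrU, hrV]; exact hrep
  { carrier := classicalGraph ℓ R
    zero_mem' := h0
    add_mem' := fun {q q'} hq hq' => by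
      simpa using add_smul_mem_classicalGraph hq hq' 1
    smul_mem' := fun c q hq => by
      simpa using add_smul_mem_classicalGraph h0 hq c }

/-! ### Single Fourier modes -/

/-- The function `a(y) e^{iκx}`. -/
def modeField (ℓ : ℝ) (k : ℤ) (a : ℝ → ℂ) (z : ℝ × ℝ) : ℂ := a z.2 * modeExp ℓ k z.1

section ModeField

variable {ℓ R : ℝ} {k : ℤ} {a b F G : ℝ → ℂ}

theorem contDiff_modeField (ha : ContDiff ℝ ∞ a) : ContDiff ℝ ∞ (modeField ℓ k a) :=
  (ha.comp contDiff_snd).mul ((contDiff_modeExp ℓ k).comp contDiff_fst)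

theorem modeField_periodic (hℓ : 0 < ℓ) (a : ℝ → ℂ) (x y : ℝ) :
    modeField ℓ k a (x + ℓ, y) = modeField ℓ k a (x, y) := by
  simp only [modeField, modeExp_add_period hℓ]

theorem dx_modeField (ha : ContDiff ℝ ∞ a) :
    dx (modeField ℓ k a) = modeField ℓ k fun y => Complex.I * wavenumber ℓ k * a y := by
  funext ⟨x, y⟩
  rw [(hasDerivAt_fst (contDiff_modeField ha) x y).unique
    ((hasDerivAt_modeExp ℓ k x).const_mul (a y))]
  simp only [modeField]
  ring

theorem dy_modeField (ha : ContDiff ℝ ∞ a) :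
    dy (modeField ℓ k a) = modeField ℓ k (deriv a) := by
  funext ⟨x, y⟩
  exact (hasDerivAt_snd (contDiff_modeField ha) x y).unique
    ((hasDerivAt_of_contDiff ha y).mul_const (modeExp ℓ k x))

theorem lap_modeField (ha : ContDiff ℝ ∞ a) :
    lap (modeField ℓ k a)
      = modeField ℓ k fun y => -(wavenumber ℓ k : ℂ) ^ 2 * a y + deriv (deriv a) y := by
  funext z
  unfold lap
  rw [dx_modeField ha, dx_modeField (contDiff_const.mul ha), dy_modeField ha,
    dy_modeField (contDiff_deriv ha)]
  simp only [modeField]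
  linear_combination (wavenumber ℓ k : ℂ) ^ 2 * a z.2 * modeExp ℓ k z.1 * Complex.I_sq

theorem advV_modeField (ha : ContDiff ℝ ∞ a) :
    advV (modeField ℓ k a) = modeField ℓ k fun y => y * (Complex.I * wavenumber ℓ k * a y) := by
  funext z
  unfold advV
  rw [dx_modeField ha]
  simp only [modeField]
  ring

theorem advU_modeField (ha : ContDiff ℝ ∞ a) :
    advU (modeField ℓ k a) (modeField ℓ k b)
      = modeField ℓ k fun y => b y + y * (Complex.I * wavenumber ℓ k * a y) := by
  funext z
  unfold advU
  rw [dx_modeField ha]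
  simp only [modeField]
  ring

theorem integral_modeField_eq_zero (ha : ∫ y in (0 : ℝ)..1, a y = 0) (x : ℝ) :
    ∫ y in (0 : ℝ)..1, modeField ℓ k a (x, y) = 0 := by
  simp only [modeField]
  rw [intervalIntegral.integral_mul_const, ha, zero_mul]

theorem IsSolenoidalMode.isSmoothSolenoidal (hℓ : 0 < ℓ)
    (h : IsSolenoidalMode (wavenumber ℓ k) F G) :
    IsSmoothSolenoidal ℓ (modeField ℓ k F) (modeField ℓ k G) where
  smooth_u := contDiff_modeField h.smooth_F
  smooth_v := contDiff_modeField h.smooth_G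
  periodic_u := modeField_periodic hℓ F
  periodic_v := modeField_periodic hℓ G
  div_free x y hy := by
    rw [dx_modeField h.smooth_F, dy_modeField h.smooth_G]
    simp only [modeField]
    linear_combination modeExp ℓ k x * h.div_free y hy
  wall_zero x := by simp [modeField, h.wall_zero]
  wall_one x := by simp [modeField, h.wall_one]
  flux_zero := integral_modeField_eq_zero h.flux_zero

/-- A curl free mode is the gradient of a function with periodic gradient. -/
theorem exists_potential (hℓ : 0 < ℓ) (ha : ContDiff ℝ ∞ a)
    (hab : ∀ y, deriv a y = Complex.I * wavenumber ℓ k * b y)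
    (hb : wavenumber ℓ k = 0 → ∀ y, b y = 0) :
    ∃ p : ℝ × ℝ → ℂ, ContDiff ℝ ∞ p ∧ (∃ c : ℂ, ∀ x y : ℝ, p (x + ℓ, y) = p (x, y) + c) ∧
      dx p = modeField ℓ k a ∧ dy p = modeField ℓ k b := by
  by_cases hκ : wavenumber ℓ k = 0
  -- For the mean mode the potential is the linear function `a 0 * x`, which is not periodic unless
  -- `a 0 = 0`: this is the mean pressure gradient.
  · have hconst : ∀ y, a y = a 0 := fun y =>
      is_const_of_deriv_eq_zero (ha.differentiable (by simp)) (fun t => by simp [hab, hκ]) y 0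
    have hp : ContDiff ℝ ∞ fun z : ℝ × ℝ => a 0 * (z.1 : ℂ) :=
      contDiff_const.mul (Complex.ofRealCLM.contDiff.comp contDiff_fst)
    refine ⟨_, hp, ⟨a 0 * ℓ, fun x y => by push_cast; ring⟩, ?_, ?_⟩
    · funext ⟨x, y⟩
      rw [(hasDerivAt_fst hp x y).unique ((hasDerivAt_ofReal x).const_mul (a 0))]
      simp [modeField, modeExp, hκ, hconst y]
    · funext ⟨x, y⟩
      rw [(hasDerivAt_snd hp x y).unique (hasDerivAt_const y (a 0 * (x : ℂ)))]
      simp [modeField, hb hκ]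
  · have hκ' : Complex.I * wavenumber ℓ k ≠ 0 :=
      mul_ne_zero Complex.I_ne_zero (by exact_mod_cast hκ)
    have hs : ContDiff ℝ ∞ fun y => (Complex.I * wavenumber ℓ k)⁻¹ * a y := contDiff_const.mul ha
    refine ⟨modeField ℓ k fun y => (Complex.I * wavenumber ℓ k)⁻¹ * a y, contDiff_modeField hs,
      ⟨0, fun x y => by rw [modeField_periodic hℓ, add_zero]⟩, ?_, ?_⟩
    · rw [dx_modeField hs]
      simp only [mul_inv_cancel_left₀ hκ']
    · rw [dy_modeField hs]
      congr 1
      funext y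
      rw [((hasDerivAt_of_contDiff ha y).const_mul _).deriv, hab, inv_mul_cancel_left₀ hκ']

/-- If `ψ` solves the equation for the stream function on the whole line with forcing by a mode that
is divergence free on the whole line, then `(-ψ', iκψ)` is the mode of a classical solution. -/
theorem exists_pressure_of_stream (hℓ : 0 < ℓ) {s : ℂ} {ψ : ℝ → ℂ}
    (hFG : IsSolenoidalMode (wavenumber ℓ k) F G)
    (hdiv : ∀ y, Complex.I * wavenumber ℓ k * F y + deriv G y = 0)
    (hG : wavenumber ℓ k = 0 → ∀ y, G y = 0) (hψ : ContDiff ℝ ∞ ψ)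
    (hode : ∀ y : ℝ, (1 / R : ℂ) * iteratedDeriv 4 ψ y
        - (s + 2 * (wavenumber ℓ k : ℂ) ^ 2 / R + Complex.I * wavenumber ℓ k * y)
          * iteratedDeriv 2 ψ y
        + (s * (wavenumber ℓ k : ℂ) ^ 2 + (wavenumber ℓ k : ℂ) ^ 4 / R
          + Complex.I * (wavenumber ℓ k : ℂ) ^ 3 * y) * ψ y
        = deriv F y - Complex.I * wavenumber ℓ k * G y)
    (h0 : ψ 0 = 0) (h1 : ψ 1 = 0) :
    ∃ u v p : ℝ × ℝ → ℂ, u = modeField ℓ k (fun y => -deriv ψ y) ∧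
      IsSmoothSolenoidal ℓ u v ∧ IsPressure ℓ R u v p ∧
      (∀ z, s * u z - modeField ℓ k F z = rhsU R u v p z) ∧
      ∀ z, s * v z - modeField ℓ k G z = rhsV R v p z := by
  set κ := wavenumber ℓ k with hκ
  set U : ℝ → ℂ := fun y => -deriv ψ y with hU
  set V : ℝ → ℂ := fun y => Complex.I * κ * ψ y with hV
  have hUs : ContDiff ℝ ∞ U := (contDiff_deriv hψ).neg
  have hVs : ContDiff ℝ ∞ V := contDiff_const.mul hψ
  have hys : ContDiff ℝ ∞ fun y : ℝ => (y : ℂ) := Complex.ofRealCLM.contDiff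
  have hU1 := contDiff_deriv hUs
  have hU2 := contDiff_deriv hU1
  have hV1 : deriv V = fun y => -(Complex.I * κ) * U y := by
    funext y
    rw [((hasDerivAt_of_contDiff hψ y).const_mul _).deriv, hU]
    ring
  have hV2 : deriv (deriv V) = fun y => -(Complex.I * κ) * deriv U y := by
    rw [hV1]; exact funext fun y => ((hasDerivAt_of_contDiff hUs y).const_mul _).deriv
  have hi2 : ∀ y, iteratedDeriv 2 ψ y = -deriv U y := fun y => by
    simp only [iteratedDeriv_succ, iteratedDeriv_zero]
    rw [hU, deriv.fun_neg, neg_neg]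
  have hi4 : ∀ y, iteratedDeriv 4 ψ y = -deriv (deriv (deriv U)) y := fun y => by
    rw [iteratedDeriv_succ, iteratedDeriv_succ, show iteratedDeriv 2 ψ = _ from funext hi2,
      show deriv (fun y => -deriv U y) = fun y => -deriv (deriv U) y from
        funext fun y => (hasDerivAt_of_contDiff hU1 y).neg.deriv]
    exact (hasDerivAt_of_contDiff hU2 y).neg.deriv
  -- The pair `(a, b)` is what the momentum equation `s w - L w = f` demands of the pressure
  -- gradient. The equation for `ψ` says precisely that it is curl free, which is `hab`.
  set a : ℝ → ℂ := fun y => (1 / R : ℂ) * (-(κ : ℂ) ^ 2 * U y + deriv (deriv U) y)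
    - (V y + y * (Complex.I * κ * U y)) - s * U y + F y with ha
  set b : ℝ → ℂ := fun y => (1 / R : ℂ) * (-(κ : ℂ) ^ 2 * V y + -(Complex.I * κ) * deriv U y)
    - y * (Complex.I * κ * V y) - s * V y + G y with hb
  have has : ContDiff ℝ ∞ a :=
    (((contDiff_const.mul ((contDiff_const.mul hUs).add hU2)).sub
      (hVs.add (hys.mul (contDiff_const.mul hUs)))).sub (contDiff_const.mul hUs)).add hFG.smooth_F
  have hbs : ContDiff ℝ ∞ b :=
    (((contDiff_const.mul ((contDiff_const.mul hVs).add (contDiff_const.mul hU1))).sub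
      (hys.mul (contDiff_const.mul hVs))).sub (contDiff_const.mul hVs)).add hFG.smooth_G
  have hV1' : ∀ y, HasDerivAt V (-(Complex.I * κ) * U y) y := fun y => by
    rw [← congrFun hV1 y]; exact hasDerivAt_of_contDiff hVs y
  have hab : ∀ y, deriv a y = Complex.I * κ * b y := by
    intro y
    have dU := hasDerivAt_of_contDiff hUs y
    refine (((((dU.const_mul _).add (hasDerivAt_of_contDiff hU2 y)).const_mul _).sub
      ((hV1' y).add ((hasDerivAt_ofReal y).mul (dU.const_mul _)))|>.sub (dU.const_mul s)).add
      (hasDerivAt_of_contDiff hFG.smooth_F y)).deriv.trans ?_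
    have h := hode y
    rw [hi2, hi4] at h
    simp only [hb, hV]
    linear_combination -h + ((κ : ℂ) ^ 2 * s * ψ y + (κ : ℂ) ^ 2 / R * deriv U y
      + (κ : ℂ) ^ 4 / R * ψ y + Complex.I * κ ^ 3 * y * ψ y) * Complex.I_sq
  have hb' : ∀ y, deriv b y = (1 / R : ℂ) * (-(κ : ℂ) ^ 2 * (-(Complex.I * κ) * U y)
      + -(Complex.I * κ) * deriv (deriv U) y)
      - (Complex.I * κ * V y + y * (Complex.I * κ * (-(Complex.I * κ) * U y)))
      - s * (-(Complex.I * κ) * U y) + deriv G y := by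
    intro y
    refine ((((((hV1' y).const_mul _).add
      ((hasDerivAt_of_contDiff hU1 y).const_mul _)).const_mul _).sub
      ((hasDerivAt_ofReal y).mul ((hV1' y).const_mul _))|>.sub ((hV1' y).const_mul s)).add
      (hasDerivAt_of_contDiff hFG.smooth_G y)).deriv.trans ?_
    ring
  obtain ⟨p, hps, hpper, hpx, hpy⟩ := exists_potential (k := k) hℓ has hab (fun h y => by
    have hκ0 : κ = 0 := h
    simp [hb, hV, hκ0, hG hκ0])
  have hrU : ∀ z, s * modeField ℓ k U z - modeField ℓ k F z
      = rhsU R (modeField ℓ k U) (modeField ℓ k V) p z := fun z => by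
    unfold rhsU
    rw [lap_modeField hUs, advU_modeField hUs, hpx]
    simp only [modeField, ha]
    ring
  have hrV : ∀ z, s * modeField ℓ k V z - modeField ℓ k G z
      = rhsV R (modeField ℓ k V) p z := fun z => by
    unfold rhsV
    rw [lap_modeField hVs, advV_modeField hVs, hpy, hV2]
    simp only [modeField, hb]
    ring
  have hUint : ∫ y in (0 : ℝ)..1, U y = 0 := by
    rw [hU, intervalIntegral.integral_neg, intervalIntegral.integral_eq_sub_of_hasDerivAt
      (fun y _ => hasDerivAt_of_contDiff hψ y)
      ((hψ.continuous_deriv (by simp)).intervalIntegrable _ _), h0, h1, sub_zero, neg_zero]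
  have hV0 : V 0 = 0 := by simp [hV, h0]
  have hV1'' : V 1 = 0 := by simp [hV, h1]
  have hmode : IsSolenoidalMode κ U V :=
    ⟨hUs, hVs, fun y _ => by rw [hV1]; ring, hV0, hV1'', hUint⟩
  refine ⟨modeField ℓ k U, modeField ℓ k V, p, rfl, hmode.isSmoothSolenoidal hℓ,
    ⟨hps, hpper, fun x y _ => ?_, fun x => ?_, fun x => ?_, fun x => ?_⟩, hrU, hrV⟩
  -- The Poisson equation is the divergence of the momentum equation, as `w` and the forcing are
  -- both divergence free.
  · unfold lap
    rw [hpx, hpy, dx_modeField has, dy_modeField hbs, advU_modeField hUs, advV_modeField hVs,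
      dx_modeField (hVs.add (hys.mul (contDiff_const.mul hUs))),
      dy_modeField (hys.mul (contDiff_const.mul hVs))]
    simp only [modeField]
    rw [((hasDerivAt_ofReal y).fun_mul ((hV1' y).const_mul _)).deriv, hb']
    linear_combination modeExp ℓ k x * hdiv y
  · rw [hpy, dy_modeField hVs, dy_modeField (contDiff_deriv hVs), hV2]
    simp only [modeField, hb, hV0, hFG.wall_zero]
    ring
  · rw [hpy, dy_modeField hVs, dy_modeField (contDiff_deriv hVs), hV2]
    simp only [modeField, hb, hV1'', hFG.wall_one]
    ring
  -- The right-hand side equals `s w - f`, and neither `w` nor `f` carries flux.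
  · simp only [← hrU, modeField, ← mul_assoc, ← sub_mul]
    rw [intervalIntegral.integral_mul_const, intervalIntegral.integral_sub,
      intervalIntegral.integral_const_mul, hUint, hFG.flux_zero, mul_zero, sub_zero, zero_mul]
    · exact (continuous_const.mul hUs.continuous).intervalIntegrable _ _
    · exact hFG.smooth_F.continuous.intervalIntegrable _ _

/-- On the strip, every solenoidal mode agrees with one that is divergence free on the line. -/
theorem IsSolenoidalMode.exists_global {κ : ℝ} (h : IsSolenoidalMode κ F G) :
    ∃ F' G', IsSolenoidalMode κ F' G' ∧ (∀ y, Complex.I * κ * F' y + deriv G' y = 0) ∧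
      (κ = 0 → ∀ y, G' y = 0) ∧ Set.EqOn F F' (Set.Icc 0 1) ∧ Set.EqOn G G' (Set.Icc 0 1) := by
  by_cases hκ : κ = 0
  · subst hκ
    -- For `κ = 0` the component `G` vanishes on the strip but perhaps not off it, so it is replaced
    -- by zero. For `κ ≠ 0` below, `G` is kept and `F` is redefined as `-(iκ)⁻¹ G'`.
    refine ⟨F, fun _ => 0, ⟨h.smooth_F, contDiff_const, by simp, rfl, rfl, h.flux_zero⟩, by simp,
      by simp, fun _ _ => rfl, fun y hy => ?_⟩
    simp [h.eq_stream hy]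
  · have hκ' : Complex.I * κ ≠ 0 := mul_ne_zero Complex.I_ne_zero (by exact_mod_cast hκ)
    have hdiv : ∀ y, Complex.I * κ * (-(Complex.I * κ)⁻¹ * deriv G y) + deriv G y = 0 :=
      fun y => by rw [neg_mul, mul_neg, mul_inv_cancel_left₀ hκ', neg_add_cancel]
    have heq : Set.EqOn F (fun y => -(Complex.I * κ)⁻¹ * deriv G y) (Set.Icc 0 1) := fun y hy => by
      have h1 := h.div_free y hy
      have h2 := hdiv y
      exact mul_left_cancel₀ hκ' (by linear_combination h1 - h2)
    refine ⟨_, G, ⟨contDiff_const.mul (contDiff_deriv h.smooth_G), h.smooth_G, fun y _ => hdiv y,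
      h.wall_zero, h.wall_one, ?_⟩, hdiv, fun h0 => absurd h0 hκ, heq, fun _ _ => rfl⟩
    rw [← h.flux_zero]
    refine (intervalIntegral.integral_congr fun y hy => ?_).symm
    rw [Set.uIcc_of_le zero_le_one] at hy
    exact heq hy

theorem IsSmoothSolenoidal.mem_solenoidal {u v : ℝ × ℝ → ℂ} (h : IsSmoothSolenoidal ℓ u v)
    {w : L2 ℓ} (hw : Represents ℓ w u v) : w ∈ solenoidal ℓ :=
  Submodule.le_topologicalClosure _ (Submodule.subset_span ⟨u, v, h, hw⟩)

/-- Every solenoidal mode is in the range of `s - L`. -/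
theorem StreamEstimate.exists_mem_classicalGraph {C : ℝ} (hℓ : 0 < ℓ) (hR : 0 < R) {s : ℂ}
    (hE : StreamEstimate ℓ R C s) (hFG : IsSolenoidalMode (wavenumber ℓ k) F G)
    {h : solenoidal ℓ} (hh : Represents ℓ h (modeField ℓ k F) (modeField ℓ k G)) :
    ∃ q ∈ classicalGraph ℓ R, s • q.1 - q.2 = h := by
  obtain ⟨F', G', hFG', hdiv, hG', hF, hG⟩ := hFG.exists_global
  have hh' : Represents ℓ h (modeField ℓ k F') (modeField ℓ k G') :=
    hh.congr (fun x y hy => by simp only [modeField, hF hy])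
      (fun x y hy => by simp only [modeField, hG hy])
  obtain ⟨ψ, hψ, hode, h0, h1, hd0, hd1⟩ := exists_stream_solution hR (fun _ => hE.eqOn_zero k)
    ((contDiff_deriv hFG'.smooth_F).sub (contDiff_const.mul hFG'.smooth_G))
  obtain ⟨u, v, p, hu, hw, hp, hrU, hrV⟩ :=
    exists_pressure_of_stream hℓ hFG' hdiv hG' hψ hode h0 h1
  obtain ⟨w, hwr⟩ := exists_represents (ℓ := ℓ) hw.smooth_u.continuous hw.smooth_v.continuous
  -- Taking `s w - h` as the value of the operator puts that value in the state space without
  -- further proof; it remains only to see that it represents the right-hand side.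
  refine ⟨(⟨w, hw.mem_solenoidal hwr⟩, s • ⟨w, hw.mem_solenoidal hwr⟩ - h),
    ⟨u, v, p, hw, fun x => ?_, fun x => ?_, hp, hwr, ?_⟩, by simp⟩
  · simp [hu, modeField, hd0]
  · simp [hu, modeField, hd1]
  · rw [← show _ = rhsU R u v p from funext hrU, ← show _ = rhsV R v p from funext hrV]
    exact (hwr.const_smul s).sub hh'

end ModeField

/-! ### Density of the range -/

/-- A smooth solenoidal field is the limit of its Fourier partial sums. -/
theorem IsSmoothSolenoidal.mem_closure {ℓ : ℝ} (hℓ : 0 < ℓ) {u v : ℝ × ℝ → ℂ}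
    (hw : IsSmoothSolenoidal ℓ u v) {h : L2 ℓ} (hh : Represents ℓ h u v)
    (D : Submodule ℂ (L2 ℓ))
    (hD : ∀ (k : ℤ) (d : L2 ℓ), Represents ℓ d (modeField ℓ k (modeCoeff ℓ k u))
      (modeField ℓ k (modeCoeff ℓ k v)) → d ∈ D) :
    h ∈ D.topologicalClosure := by
  -- Removing the modes in `S` leaves a continuous remainder whose other coefficients are unchanged.
  -- Parseval's identity then gives its squared norm as the tail of a convergent series.
  have key : ∀ S : Finset ℤ, ∃ d ∈ D, ∃ u' v' : ℝ × ℝ → ℂ, Continuous u' ∧ Continuous v' ∧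
      Represents ℓ (h - d) u' v' ∧
      (∀ j y, modeCoeff ℓ j u' y = if j ∈ S then 0 else modeCoeff ℓ j u y) ∧
      ∀ j y, modeCoeff ℓ j v' y = if j ∈ S then 0 else modeCoeff ℓ j v y := by
    intro S
    induction S using Finset.induction_on with
    | empty =>
      exact ⟨0, D.zero_mem, u, v, hw.smooth_u.continuous, hw.smooth_v.continuous,
        by simpa using hh, by simp, by simp⟩
    | insert k S hk ih =>
      obtain ⟨d, hd, u', v', hu', hv', hr, hcu, hcv⟩ := ih
      have cu : Continuous (modeField ℓ k (modeCoeff ℓ k u)) :=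
        (contDiff_modeField (contDiff_modeCoeff hw.smooth_u)).continuous
      have cv : Continuous (modeField ℓ k (modeCoeff ℓ k v)) :=
        (contDiff_modeField (contDiff_modeCoeff hw.smooth_v)).continuous
      obtain ⟨e, he⟩ := exists_represents (ℓ := ℓ) cu cv
      refine ⟨d + e, D.add_mem hd (hD k e he), fun z => u' z - modeField ℓ k (modeCoeff ℓ k u) z,
        fun z => v' z - modeField ℓ k (modeCoeff ℓ k v) z, hu'.sub cu, hv'.sub cv, ?_, ?_, ?_⟩
      · rw [← sub_sub]
        exact hr.sub he
      · intro j y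
        have hm : modeCoeff ℓ j (modeField ℓ k (modeCoeff ℓ k u)) y = _ :=
          modeCoeff_mul_modeExp hℓ k (modeCoeff ℓ k u) y
        rw [modeCoeff_sub hu' cu, hcu, hm]
        by_cases hkj : k = j
        · subst hkj; simp [hk]
        · simp [hkj, Ne.symm hkj]
      · intro j y
        have hm : modeCoeff ℓ j (modeField ℓ k (modeCoeff ℓ k v)) y = _ :=
          modeCoeff_mul_modeExp hℓ k (modeCoeff ℓ k v) y
        rw [modeCoeff_sub hv' cv, hcv, hm]
        by_cases hkj : k = j
        · subst hkj; simp [hk]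
        · simp [hkj, Ne.symm hkj]
  have hsum := hh.hasSum hℓ hw.smooth_u.continuous hw.smooth_v.continuous
  set t : ℤ → ℝ := fun k => ℓ * (normSq (modeCoeff ℓ k u) + normSq (modeCoeff ℓ k v)) with ht
  change h ∈ closure (D : Set (L2 ℓ))
  rw [Metric.mem_closure_iff]
  intro ε hε
  obtain ⟨S, hS⟩ := ((Metric.tendsto_nhds.mp hsum) (ε ^ 2) (by positivity)).exists
  obtain ⟨d, hd, u', v', hu', hv', hr, hcu, hcv⟩ := key S
  refine ⟨d, hd, ?_⟩
  have h1 := hr.hasSum hℓ hu' hv'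
  have h2 : HasSum (fun k => t k - if k ∈ S then t k else 0) (‖h‖ ^ 2 - ∑ k ∈ S, t k) := by
    refine hsum.sub ?_
    have := hasSum_sum_of_ne_finset_zero
      (L := SummationFilter.unconditional ℤ) (f := fun k => if k ∈ S then t k else 0) (s := S)
      (fun k hk => by simp [hk])
    simpa [Finset.sum_ite_mem] using this
  have h3 : ‖h - d‖ ^ 2 = ‖h‖ ^ 2 - ∑ k ∈ S, t k := by
    refine h1.unique (h2.congr_fun ?_)
    intro k
    by_cases hk : k ∈ S <;> simp [hk, ht, normSq, hcu, hcv]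
  rw [dist_eq_norm]
  refine lt_of_pow_lt_pow_left₀ 2 hε.le ?_
  rw [h3]
  rw [Real.dist_eq, abs_sub_comm] at hS
  exact (le_abs_self _).trans_lt hS

theorem StreamEstimate.dense_range {ℓ R C : ℝ} (hℓ : 0 < ℓ) (hR : 0 < R) {s : ℂ}
    (hE : StreamEstimate ℓ R C s) :
    Dense {h : solenoidal ℓ | ∃ q ∈ classicalSubmodule ℓ R, s • q.1 - q.2 = h} := by
  let T : solenoidal ℓ × solenoidal ℓ →ₗ[ℂ] solenoidal ℓ :=
    s • LinearMap.fst ℂ (solenoidal ℓ) (solenoidal ℓ) - LinearMap.snd ℂ _ _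
  -- The range of `s - L` is viewed in the ambient `L₂`, where its closure can be compared with the
  -- closed span defining the state space.
  let D : Submodule ℂ (L2 ℓ) := ((classicalSubmodule ℓ R).map T).map (solenoidal ℓ).subtype
  have hle : solenoidal ℓ ≤ D.topologicalClosure := by
    refine Submodule.topologicalClosure_minimal _ (Submodule.span_le.mpr ?_)
      D.isClosed_topologicalClosure
    rintro h ⟨u, v, hw, hh⟩
    refine hw.mem_closure hℓ hh D fun k d hd => ?_
    have hmode := hw.isSolenoidalMode hℓ k
    obtain ⟨q, hq, hqd⟩ := hE.exists_mem_classicalGraph hℓ hR hmode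
      (h := ⟨d, (hmode.isSmoothSolenoidal hℓ).mem_solenoidal hd⟩) hd
    exact ⟨_, ⟨q, hq, hqd⟩, rfl⟩
  rw [Subtype.dense_iff]
  intro h hh
  exact hle hh

end Couette

end

/-! ### The resolvent bound. -/

theorem lemma2 (ℓ R C : ℝ) (hℓ : 0 < ℓ) (hR : 0 < R) (hC : 0 ≤ C)
    (s : ℂ) (hs : ‖s‖ < 2 * Real.sqrt 2 * (1 + Real.sqrt R))
    (hψ : ∀ (k : ℤ) (F G ψ : ℝ → ℂ),
      Couette.IsSolenoidalMode (Couette.wavenumber ℓ k) F G →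
      Couette.IsStreamSolution R (Couette.wavenumber ℓ k) s F G ψ →
      Couette.wavenumber ℓ k ^ 2 * Couette.normSq ψ
          ≤ C * R ^ 2 * (Couette.normSq F + Couette.normSq G) ∧
        Couette.normSq (deriv ψ)
          ≤ C * R ^ 2 * (Couette.normSq F + Couette.normSq G)) :
    ∃ S : Couette.solenoidal ℓ →L[ℂ] Couette.solenoidal ℓ,
      Couette.IsResolvent (Couette.operatorGraph ℓ R) s S ∧ ‖S‖ ^ 2 ≤ 2 * C * R ^ 2 := by
  have hE : Couette.StreamEstimate ℓ R C s := hψ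
  have hM : 0 ≤ 2 * C * R ^ 2 := by positivity
  have : CompleteSpace (Couette.solenoidal ℓ) :=
    (Submodule.isClosed_topologicalClosure _).completeSpace_coe
  obtain ⟨S, hS, hn⟩ := Couette.exists_isResolvent_closure (Couette.classicalSubmodule ℓ R) s
    (Real.sqrt_nonneg (2 * C * R ^ 2)) (fun q hq => by
      have h := Real.le_sqrt_of_sq_le (hE.norm_sq_le hℓ hq)
      rwa [Real.sqrt_mul hM, Real.sqrt_sq (norm_nonneg _)] at h)
    (hE.dense_range hℓ hR)
  refine ⟨S, hS, ?_⟩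
  calc ‖S‖ ^ 2 ≤ Real.sqrt (2 * C * R ^ 2) ^ 2 := by gcongr
    _ = 2 * C * R ^ 2 := Real.sq_sqrt hM
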